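/- Let $n\ge 0$ be an integer, $\alpha>1/(n+1)$, and let $T,M$ be real numbers. All functions of two times are considered for $0\le a\le b<T$. A function $u(a,b)$ is called multiplicative if $u(a,b)=u(a,c)\,u(c,b)$ whenever $0\le a\le c\le b<T$. (1) Let $\mathcal A$ be a real Banach algebra with unit, and let $A^{(k)}_{ab}\in\mathcal A$ ($0\le k\le n$) satisfy, for every $k\le n$, $$A^{(k)}_{ab}=\sum_{i=0}^{k}A^{(i)}_{ac}A^{(k-i)}_{cb}\quad(0\le a\le c\le b<T),\qquad |A^{(k)}_{ab}|\le M|b-a|^{k\alpha}\quad(0\le a\le b<T).$$ For $\lambda\in\mathbb R$ put $\mu_\lambda(a,b)=\sum_{k=0}^n\lambda^kA^{(k)}_{ab}$. Then for every $\lambda\in\mathbb R$ there is a unique multiplicative function $u_\lambda(a,b)$ with values in $\mathcal A$ for which there is a constant $C$ such that $$|u_\lambda(a,b)-\mu_\lambda(a,b)|\le C\,|b-a|^{(n+1)\alpha}\qquad(0\le a\le b<T).$$ Moreover there are $B^{(k)}_{ab}\in\mathcal A$ ($k\ge n+1$), not depending on $\lambda$, such that for every $\lambda\in\mathbb R$ $$u_\lambda(a,b)=\sum_{k=0}^n\lambda^kA^{(k)}_{ab}+\sum_{k=n+1}^\infty\lambda^kB^{(k)}_{ab}\qquad(0\le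 a\le b<T),$$ and for every $\lambda$ this series is normally convergent, i.e. its terms are bounded in norm, uniformly in $(a,b)$, by the terms of a convergent numerical series. (2) Let $E$ be a real Banach space, and suppose that every tensor power $E^{\otimes k}$ ($k\ge 0$) carries a cross-norm $\|\cdot\|_k$ (that is, $\|x_1\otimes\cdots\otimes x_k\|_k=\|x_1\|\cdots\|x_k\|$ for $x_1,\dots,x_k\in E$) such that $\|u\otimes v\|_{i+j}\le\|u\|_i\|v\|_j$ for $u\in E^{\otimes i}$, $v\in E^{\otimes j}$. Let $\mathcal A$ be the Banach algebra obtained by completing the tensor algebra of $E$ under the norm $\|t\|=\sum_{k\ge0}\|t_k\|_k$, and let $E^k\subset\mathcal A$ be the closure of $E^{\otimes k}$, that is, the completion of $E^{\otimes k}$ under $\|\cdot\|_k$. For $k\le n$ let $X^{(k)}_{ab}\in E^k$ satisfy $$X^{(k)}_{ab}=\sum_{i=0}^{k}X^{(i)}_{ac}\otimes X^{(k-i)}_{cb}\quad(0\le a\le c\le b<T),\qquad \|X^{(k)}_{ab}\|_k\le M|b-a|^{k\alpha}\quad(0\le a\le b<T).$$ Then there is a unique family $Y^{(k)}_{ab}\in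 E^k$ ($k\ge0$, $0\le a\le b<T$) such that $Y^{(k)}=X^{(k)}$ for $k\le n$, $$Y^{(k)}_{ab}=\sum_{i=0}^{k}Y^{(i)}_{ac}\otimes Y^{(k-i)}_{cb}\qquad\text{for every }k\ge0\text{ and }0\le a\le c\le b<T,$$ and, for some constant $C$, $$\sum_{k\ge n+1}\|Y^{(k)}_{ab}\|_k\le C\,|b-a|^{(n+1)\alpha}\qquad(0\le a\le b<T).$$ -/

import Mathlib

open scoped TensorProduct DirectSum

/-- A function `u` of two times is multiplicative on `0 ≤ a ≤ b < T` if
`u a b = u a c * u c b` whenever `a ≤ c ≤ b`. Only the values of `u` at pairs of times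
`0 ≤ a ≤ b < T` matter. -/
def IsMultiplicative {R : Type*} [Mul R] (T : ℝ) (u : ℝ → ℝ → R) : Prop :=
  ∀ a c b : ℝ, 0 ≤ a → a ≤ c → c ≤ b → b < T → u a b = u a c * u c b

/-- The algebraic relation of degree `k`: `A k a b = ∑_{i + j = k} A i a c * A j c b` for all
`0 ≤ a ≤ c ≤ b < T`. -/
def ChenRelation {R : Type*} [NonUnitalNonAssocSemiring R] (T : ℝ) (A : ℕ → ℝ → ℝ → R)
    (k : ℕ) : Prop :=
  ∀ a c b : ℝ, 0 ≤ a → a ≤ c → c ≤ b → b < T →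
    A k a b = ∑ p ∈ Finset.HasAntidiagonal.antidiagonal k, A p.1 a c * A p.2 c b

/-- `u` and `v` differ by at most `Cst |b - a|^β` on `0 ≤ a ≤ b < T`. -/
def HolderClose {R : Type*} [NormedRing R] (T β : ℝ) (u v : ℝ → ℝ → R) : Prop :=
  ∃ C : ℝ, ∀ a b : ℝ, 0 ≤ a → a ≤ b → b < T → ‖u a b - v a b‖ ≤ C * (b - a) ^ β

/-- A family of cross-norms on the tensor powers `E^{⊗k}` of a Banach space `E`, compatible with
the tensor products `E^{⊗i} × E^{⊗j} → E^{⊗(i+j)}`. -/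
structure TensorCrossNorms (E : Type*) [NormedAddCommGroup E] [NormedSpace ℝ E] where
  /-- The norm on `E^{⊗k}`. -/
  nrm : ∀ k : ℕ, (⨂[ℝ]^k E) → ℝ
  add_le' : ∀ (k : ℕ) (u v : ⨂[ℝ]^k E), nrm k (u + v) ≤ nrm k u + nrm k v
  smul' : ∀ (k : ℕ) (r : ℝ) (u : ⨂[ℝ]^k E), nrm k (r • u) = |r| * nrm k u
  eq_zero' : ∀ (k : ℕ) (u : ⨂[ℝ]^k E), nrm k u = 0 → u = 0
  /-- The cross property: `‖x₁ ⊗ ⋯ ⊗ x_k‖ = ‖x₁‖ ⋯ ‖x_k‖`. -/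
  cross : ∀ (k : ℕ) (x : Fin k → E), nrm k (PiTensorProduct.tprod ℝ x) = ∏ i, ‖x i‖
  /-- `‖u ⊗ v‖ ≤ ‖u‖ ‖v‖`. -/
  tmul_le : ∀ (i j : ℕ) (u : ⨂[ℝ]^i E) (v : ⨂[ℝ]^j E),
    nrm (i + j) (TensorPower.mulEquiv (u ⊗ₜ[ℝ] v)) ≤ nrm i u * nrm j v

namespace TensorCrossNorms

variable {E : Type*} [NormedAddCommGroup E] [NormedSpace ℝ E] (N : TensorCrossNorms E)

theorem nrm_zero (k : ℕ) : N.nrm k 0 = 0 := by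
  have := N.smul' k 0 0
  simpa using this

theorem nrm_neg (k : ℕ) (u : ⨂[ℝ]^k E) : N.nrm k (-u) = N.nrm k u := by
  have := N.smul' k (-1) u
  rw [neg_one_smul] at this
  simpa using this

theorem nrm_nonneg (k : ℕ) (u : ⨂[ℝ]^k E) : 0 ≤ N.nrm k u := by
  have h := N.add_le' k u (-u)
  rw [add_neg_cancel, N.nrm_zero, N.nrm_neg] at h
  linarith

/-- The tensor algebra of `E`, to be normed by `‖t‖ = ∑ k, ‖t_k‖_k`. -/
def PreAlg (_N : TensorCrossNorms E) : Type _ := TensorAlgebra ℝ E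

noncomputable instance : Ring N.PreAlg := inferInstanceAs (Ring (TensorAlgebra ℝ E))

noncomputable instance : Algebra ℝ N.PreAlg := inferInstanceAs (Algebra ℝ (TensorAlgebra ℝ E))

/-- The component of degree `k`, an element of `E^{⊗k}`. -/
noncomputable def comp (k : ℕ) (t : N.PreAlg) : ⨂[ℝ]^k E :=
  (TensorAlgebra.toDirectSum (R := ℝ) (M := E) t) k

/-- The inclusion of `E^{⊗k}` into the tensor algebra. -/
noncomputable def incl (k : ℕ) : (⨂[ℝ]^k E) →ₗ[ℝ] N.PreAlg :=
  (TensorPower.toTensorAlgebra : (⨂[ℝ]^k E) →ₗ[ℝ] TensorAlgebra ℝ E)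

theorem comp_add (k : ℕ) (s t : N.PreAlg) : N.comp k (s + t) = N.comp k s + N.comp k t := by
  have h := map_add (TensorAlgebra.toDirectSum (R := ℝ) (M := E)) s t
  exact (DFunLike.congr_fun h k).trans (DirectSum.add_apply _ _ _)

theorem comp_smul (k : ℕ) (r : ℝ) (t : N.PreAlg) : N.comp k (r • t) = r • N.comp k t := by
  have h := map_smul (TensorAlgebra.toDirectSum (R := ℝ) (M := E)) r (t : TensorAlgebra ℝ E)
  exact (DFunLike.congr_fun h k).trans (DirectSum.smul_apply _ _ _)

theorem comp_zero (k : ℕ) : N.comp k 0 = 0 := by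
  have h := N.comp_smul k 0 0
  rwa [zero_smul, zero_smul] at h

theorem comp_ext {s t : N.PreAlg} (h : ∀ k, N.comp k s = N.comp k t) : s = t :=
  (TensorAlgebra.equivDirectSum (R := ℝ) (M := E)).injective (DFinsupp.ext h)

theorem toDirectSum_incl (k : ℕ) (u : ⨂[ℝ]^k E) :
    TensorAlgebra.toDirectSum (R := ℝ) (M := E) (N.incl k u) = DirectSum.of _ k u := by
  have h : TensorAlgebra.ofDirectSum (R := ℝ) (M := E) (DirectSum.of _ k u) = N.incl k u :=
    DirectSum.toAddMonoid_of (fun m ↦ LinearMap.toAddMonoidHom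
      (TensorPower.toTensorAlgebra : (⨂[ℝ]^m E) →ₗ[ℝ] TensorAlgebra ℝ E)) k u
  rw [← h]
  exact TensorAlgebra.toDirectSum_ofDirectSum _

theorem comp_incl_self (k : ℕ) (u : ⨂[ℝ]^k E) : N.comp k (N.incl k u) = u := by
  unfold comp
  rw [toDirectSum_incl]
  exact DirectSum.of_eq_same _ _

theorem comp_incl_of_ne {k l : ℕ} (h : l ≠ k) (u : ⨂[ℝ]^k E) : N.comp l (N.incl k u) = 0 := by
  unfold comp
  rw [toDirectSum_incl]
  exact DirectSum.of_eq_of_ne _ _ _ h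

theorem finite_comp (t : N.PreAlg) : {k | N.comp k t ≠ 0}.Finite := by
  classical
  refine (Finset.finite_toSet
    (DFinsupp.support (TensorAlgebra.toDirectSum (R := ℝ) (M := E) t))).subset fun k hk ↦ ?_
  exact (DFinsupp.mem_support_iff).2 hk

theorem finite_nrm_comp (t : N.PreAlg) :
    (Function.support fun k ↦ N.nrm k (N.comp k t)).Finite := by
  refine (N.finite_comp t).subset fun k hk h0 ↦ hk ?_
  change N.nrm k (N.comp k t) = 0
  rw [show N.comp k t = 0 from h0, N.nrm_zero]

/-- The norm `‖t‖ = ∑ k, ‖t_k‖_k` (a sum with finitely many nonzero terms). -/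
noncomputable instance : Norm N.PreAlg := ⟨fun t ↦ ∑ᶠ k, N.nrm k (N.comp k t)⟩

theorem norm_def (t : N.PreAlg) : ‖t‖ = ∑ᶠ k, N.nrm k (N.comp k t) := rfl

theorem preNorm_zero : ‖(0 : N.PreAlg)‖ = 0 := by
  simp [norm_def, comp_zero, nrm_zero]

theorem norm_eq_sum_of_subset (t : N.PreAlg) (s : Finset ℕ)
    (h : (N.finite_comp t).toFinset ⊆ s) : ‖t‖ = ∑ k ∈ s, N.nrm k (N.comp k t) := by
  rw [norm_def]
  refine finsum_eq_sum_of_support_subset _ fun k hk ↦ h ?_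
  rw [Set.Finite.mem_toFinset]
  intro h0
  apply hk
  change N.nrm k (N.comp k t) = 0
  rw [h0, N.nrm_zero]

theorem preNorm_add_le (s t : N.PreAlg) : ‖s + t‖ ≤ ‖s‖ + ‖t‖ := by
  classical
  set F := (N.finite_comp s).toFinset ∪ (N.finite_comp t).toFinset ∪
    (N.finite_comp (s + t)).toFinset
  have h1 : (N.finite_comp s).toFinset ⊆ F := fun k hk ↦ by simp [F, hk]
  have h2 : (N.finite_comp t).toFinset ⊆ F := fun k hk ↦ by simp [F, hk]
  have h3 : (N.finite_comp (s + t)).toFinset ⊆ F := Finset.subset_union_right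
  rw [N.norm_eq_sum_of_subset s F h1, N.norm_eq_sum_of_subset t F h2,
    N.norm_eq_sum_of_subset (s + t) F h3, ← Finset.sum_add_distrib]
  refine Finset.sum_le_sum fun k _ ↦ ?_
  rw [comp_add]
  exact N.add_le' k _ _

theorem preNorm_smul (r : ℝ) (t : N.PreAlg) : ‖r • t‖ = |r| * ‖t‖ := by
  simp only [norm_def, comp_smul, N.smul']
  exact (mul_finsum' _ _ (N.finite_nrm_comp t)).symm

theorem preNorm_neg (t : N.PreAlg) : ‖-t‖ = ‖t‖ := by
  have := N.preNorm_smul (-1) t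
  rw [neg_one_smul] at this
  simpa using this

theorem preNorm_eq_zero (t : N.PreAlg) (h : ‖t‖ = 0) : t = 0 := by
  refine N.comp_ext fun k ↦ ?_
  rw [comp_zero]
  refine N.eq_zero' k _ (le_antisymm ?_ (N.nrm_nonneg k _))
  rw [← h, norm_def]
  exact single_le_finsum k (N.finite_nrm_comp t) fun j ↦ N.nrm_nonneg j _

/-- On `E^{⊗k}` the norm of the tensor algebra is the given cross-norm. -/
theorem norm_incl (k : ℕ) (u : ⨂[ℝ]^k E) : ‖N.incl k u‖ = N.nrm k u := by
  rw [norm_def, finsum_eq_single _ k, comp_incl_self]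
  intro l hl
  rw [N.comp_incl_of_ne hl, nrm_zero]

theorem incl_mul_incl (i j : ℕ) (u : ⨂[ℝ]^i E) (v : ⨂[ℝ]^j E) :
    N.incl i u * N.incl j v = N.incl (i + j) (TensorPower.mulEquiv (u ⊗ₜ[ℝ] v)) :=
  (TensorPower.toTensorAlgebra_gMul u v).symm

theorem preNorm_sum_le {ι : Type*} (s : Finset ι) (f : ι → N.PreAlg) :
    ‖∑ i ∈ s, f i‖ ≤ ∑ i ∈ s, ‖f i‖ :=
  Finset.le_sum_of_subadditive _ N.preNorm_zero.le N.preNorm_add_le s f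

theorem eq_sum_incl (t : N.PreAlg) :
    t = ∑ k ∈ (N.finite_comp t).toFinset, N.incl k (N.comp k t) := by
  have hsum : ∀ (l : ℕ) (s : Finset ℕ) (f : ℕ → N.PreAlg),
      N.comp l (∑ k ∈ s, f k) = ∑ k ∈ s, N.comp l (f k) := fun l s f ↦
    map_sum (AddMonoidHom.mk' (N.comp l) (N.comp_add l)) f s
  refine N.comp_ext fun l ↦ ?_
  rw [hsum, Finset.sum_eq_single l, comp_incl_self]
  · intro k _ hk
    exact N.comp_incl_of_ne hk.symm _
  · intro hl
    rw [comp_incl_self]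
    simpa using hl

theorem norm_eq_sum (t : N.PreAlg) :
    ‖t‖ = ∑ k ∈ (N.finite_comp t).toFinset, N.nrm k (N.comp k t) :=
  N.norm_eq_sum_of_subset t _ subset_rfl

theorem preNorm_mul_le (s t : N.PreAlg) : ‖s * t‖ ≤ ‖s‖ * ‖t‖ := by
  conv_lhs => rw [N.eq_sum_incl s, N.eq_sum_incl t, Finset.sum_mul_sum]
  rw [N.norm_eq_sum s, N.norm_eq_sum t, Finset.sum_mul_sum]
  refine (N.preNorm_sum_le _ _).trans (Finset.sum_le_sum fun i _ ↦ ?_)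
  refine (N.preNorm_sum_le _ _).trans (Finset.sum_le_sum fun j _ ↦ ?_)
  rw [incl_mul_incl, norm_incl]
  exact N.tmul_le i j _ _

noncomputable instance : NormedAddCommGroup N.PreAlg :=
  AddGroupNorm.toNormedAddCommGroup
    { toFun := fun t ↦ ‖t‖
      map_zero' := N.preNorm_zero
      add_le' := N.preNorm_add_le
      neg' := N.preNorm_neg
      eq_zero_of_map_eq_zero' := N.preNorm_eq_zero }

noncomputable instance : NormedRing N.PreAlg where
  __ := (inferInstance : Ring N.PreAlg)
  __ := (inferInstance : NormedAddCommGroup N.PreAlg)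
  norm_mul_le := N.preNorm_mul_le

noncomputable instance : NormedAlgebra ℝ N.PreAlg where
  norm_smul_le r t := (N.preNorm_smul r t).le

/-- The completed tensor algebra: the completion of the tensor algebra of `E` under the norm
`‖t‖ = ∑ k, ‖t_k‖_k`. -/
abbrev Alg (N : TensorCrossNorms E) : Type _ := UniformSpace.Completion N.PreAlg

/-- The completed tensor algebra is a Banach algebra. -/
noncomputable instance : NormedAlgebra ℝ N.Alg where
  norm_smul_le r t := norm_smul_le r t

/-- The completed tensor power of degree `k`: the closure of `E^{⊗k}` in the completed tensor
algebra. The norm of `N.Alg` restricts there to the extension of the cross-norm of `E^{⊗k}`, and the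
product of `N.Alg` restricts to the tensor product. -/
noncomputable def level (k : ℕ) : Submodule ℝ N.Alg :=
  ((UniformSpace.Completion.toComplL (𝕜 := ℝ) (E := N.PreAlg)).toLinearMap ∘ₗ
    N.incl k).range.topologicalClosure

/-- `Y` is a multiplicative extension to all degrees of the functional `X`, which is given in the
degrees `k ≤ n`: it is valued in the completed tensor powers, agrees with `X` up to degree `n`,
satisfies the algebraic relations in every degree, and the sum of the norms of its components of
degree `k ≥ n + 1` is at most `Cst |b - a|^((n + 1) α)`. -/
def IsExtension (n : ℕ) (T α : ℝ) (X Y : ℕ → ℝ → ℝ → N.Alg) : Prop :=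
  (∀ k, ∀ a b : ℝ, 0 ≤ a → a ≤ b → b < T → Y k a b ∈ N.level k) ∧
  (∀ k ≤ n, ∀ a b : ℝ, 0 ≤ a → a ≤ b → b < T → Y k a b = X k a b) ∧
  (∀ k, ChenRelation T Y k) ∧
  ∃ C : ℝ, ∀ a b : ℝ, 0 ≤ a → a ≤ b → b < T →
    Summable (fun k ↦ ‖Y (n + 1 + k) a b‖) ∧
    ∑' k, ‖Y (n + 1 + k) a b‖ ≤ C * (b - a) ^ (((n : ℝ) + 1) * α)

end TensorCrossNorms

section Sewing

variable {R : Type*} [NormedRing R]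

/-- If `P`, `Q` are bounded and multiplicative, and `W` is a derivation along `(P, Q)` which is
small of order `θ > 1`, then `W` vanishes. -/
theorem eq_zero_of_derivation_of_norm_le {T M C θ : ℝ} (hθ : 1 < θ) {P Q W : ℝ → ℝ → R}
    (hP : IsMultiplicative T P) (hQ : IsMultiplicative T Q)
    (hPM : ∀ a b : ℝ, 0 ≤ a → a ≤ b → b < T → ‖P a b‖ ≤ M)
    (hQM : ∀ a b : ℝ, 0 ≤ a → a ≤ b → b < T → ‖Q a b‖ ≤ M)
    (hW : ∀ a c b : ℝ, 0 ≤ a → a ≤ c → c ≤ b → b < T → W a b = P a c * W c b + W a c * Q c b)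
    (hWC : ∀ a b : ℝ, 0 ≤ a → a ≤ b → b < T → ‖W a b‖ ≤ C * (b - a) ^ θ)
    {a b : ℝ} (ha : 0 ≤ a) (hab : a ≤ b) (hb : b < T) : W a b = 0 := by
  have hM : 0 ≤ M := (norm_nonneg _).trans (hPM a b ha hab hb)
  have hdiag : ∀ a, 0 ≤ a → a < T → W a a = 0 := fun a ha haT ↦ by
    have h := hWC a a ha le_rfl haT
    rw [sub_self, Real.zero_rpow (by linarith), mul_zero] at h
    exact norm_le_zero_iff.1 h
  set q : ℝ := 2 * (1 / 2) ^ θ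
  have hq0 : 0 ≤ q := by positivity
  have hq1 : q < 1 := by
    have h := Real.rpow_lt_rpow_of_exponent_gt (x := 1 / 2) (by norm_num) (by norm_num) hθ
    rw [Real.rpow_one] at h
    simp only [q]
    linarith
  have key : ∀ m : ℕ, ∀ x a b y : ℝ, 0 ≤ x → x ≤ a → a ≤ b → b ≤ y → y < T →
      ‖P x a * W a b * Q b y‖ ≤ M * M * C * (q ^ m * (b - a) ^ θ) := by
    intro m
    induction m with
    | zero =>
      intro x a b y hx hxa hab hby hy
      have h1 := hPM x a hx hxa (by linarith)
      have h2 := hQM b y (by linarith) hby hy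
      have h3 := hWC a b (by linarith) hab (by linarith)
      calc ‖P x a * W a b * Q b y‖ ≤ ‖P x a‖ * ‖W a b‖ * ‖Q b y‖ := norm_mul₃_le
        _ ≤ M * (C * (b - a) ^ θ) * M := by
          gcongr
          exact mul_nonneg hM ((norm_nonneg _).trans h3)
        _ = _ := by ring
    | succ m ih =>
      intro x a b y hx hxa hab hby hy
      set c := (a + b) / 2 with hc
      have hac : a ≤ c := by linarith
      have hcb : c ≤ b := by linarith
      have h1 := ih x c b y hx (by linarith) hcb hby hy
      have h2 := ih x a c y hx hxa hac (by linarith) hy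
      have e1 : b - c = (1 / 2) * (b - a) := by rw [hc]; ring
      have e2 : c - a = (1 / 2) * (b - a) := by rw [hc]; ring
      rw [e1, Real.mul_rpow (by norm_num) (by linarith)] at h1
      rw [e2, Real.mul_rpow (by norm_num) (by linarith)] at h2
      have e : P x a * W a b * Q b y = P x c * W c b * Q b y + P x a * W a c * Q c y := by
        rw [hW a c b (by linarith) hac hcb (by linarith),
          hP x a c hx hxa hac (by linarith), hQ c b y (by linarith) hcb hby hy]
        noncomm_ring
      rw [e]
      refine (norm_add_le _ _).trans ((add_le_add h1 h2).trans_eq ?_)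
      simp only [q]
      ring
  have e : W a b = P a a * W a b * Q b b := by
    have h1 := hW a a b ha le_rfl hab hb
    rw [hdiag a ha (by linarith), zero_mul, add_zero] at h1
    have h2 := hW a b b ha hab le_rfl hb
    rw [hdiag b (by linarith) hb, mul_zero, zero_add] at h2
    rw [← h1, ← h2]
  have hlim : Filter.Tendsto (fun m : ℕ ↦ M * M * C * (q ^ m * (b - a) ^ θ)) Filter.atTop
      (nhds 0) := by
    have := ((tendsto_pow_atTop_nhds_zero_of_lt_one hq0 hq1).mul_const ((b - a) ^ θ)).const_mul
      (M * M * C)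
    simpa using this
  rw [e]
  exact norm_le_zero_iff.1 (ge_of_tendsto' hlim fun m ↦ key m a a b b ha le_rfl hab le_rfl hb)

/-- `D` is a cocycle along the bounded multiplicative function `P`, small of order `θ`. -/
structure IsCocycle (T M K θ : ℝ) (P : ℝ → ℝ → R) (D : ℝ → ℝ → ℝ → R) : Prop where
  one_lt : 1 < θ
  nonneg_M : 0 ≤ M
  nonneg_K : 0 ≤ K
  mul : IsMultiplicative T P
  norm_P_le : ∀ a b : ℝ, 0 ≤ a → a ≤ b → b < T → ‖P a b‖ ≤ M
  norm_D_le : ∀ a c b : ℝ, 0 ≤ a → a ≤ c → c ≤ b → b < T → ‖D a c b‖ ≤ K * (b - a) ^ θ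
  left : ∀ a b : ℝ, 0 ≤ a → a ≤ b → b < T → D a a b = 0
  right : ∀ a b : ℝ, 0 ≤ a → a ≤ b → b < T → D a b b = 0
  P_mul_D : ∀ a c b : ℝ, 0 ≤ a → a ≤ c → c ≤ b → b < T → P a a * D a c b = D a c b
  D_mul_P : ∀ a c b : ℝ, 0 ≤ a → a ≤ c → c ≤ b → b < T → D a c b * P b b = D a c b
  cocycle : ∀ a c d b : ℝ, 0 ≤ a → a ≤ c → c ≤ d → d ≤ b → b < T →
    P a c * D c d b + D a c b = D a c d * P d b + D a d b

/-- The approximation at depth `m` of the sewing of `D` between `a` and `b`, along the dyadic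
subdivision of the cell `[s, t]`. -/
noncomputable def sewApprox (P : ℝ → ℝ → R) (D : ℝ → ℝ → ℝ → R) :
    ℕ → ℝ → ℝ → ℝ → ℝ → R
  | 0, _, _, _, _ => 0
  | m + 1, s, t, a, b =>
    D a (max a (min ((s + t) / 2) b)) b +
      P a (max a (min ((s + t) / 2) b)) *
        sewApprox P D m ((s + t) / 2) t (max a (min ((s + t) / 2) b)) b +
      sewApprox P D m s ((s + t) / 2) a (max a (min ((s + t) / 2) b)) *
        P (max a (min ((s + t) / 2) b)) b

namespace IsCocycle

variable {T M K θ : ℝ} {P : ℝ → ℝ → R} {D : ℝ → ℝ → ℝ → R}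

theorem sewApprox_self (h : IsCocycle T M K θ P D) (m : ℕ) (s t : ℝ) {a : ℝ} (ha : 0 ≤ a)
    (haT : a < T) : sewApprox P D m s t a a = 0 := by
  induction m generalizing s t with
  | zero => rfl
  | succ m ih =>
    have e : max a (min ((s + t) / 2) a) = a := max_eq_left (min_le_right _ _)
    rw [sewApprox, e, ih, ih, h.left a a ha le_rfl haT]
    simp

theorem unit_mul_sewApprox (h : IsCocycle T M K θ P D) (m : ℕ) (s t : ℝ) {a b : ℝ} (ha : 0 ≤ a)
    (hab : a ≤ b) (hb : b < T) : P a a * sewApprox P D m s t a b = sewApprox P D m s t a b := by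
  induction m generalizing s t b with
  | zero => simp [sewApprox]
  | succ m ih =>
    rw [sewApprox]
    set d := max a (min ((s + t) / 2) b)
    have had : a ≤ d := le_max_left _ _
    have hdb : d ≤ b := max_le hab (min_le_right _ _)
    rw [mul_add, mul_add, h.P_mul_D a d b ha had hdb hb, ← mul_assoc, ← mul_assoc,
      ← h.mul a a d ha le_rfl had (by linarith), ih _ _ had (by linarith)]

theorem sewApprox_mul_unit (h : IsCocycle T M K θ P D) (m : ℕ) (s t : ℝ) {a b : ℝ} (ha : 0 ≤ a)
    (hab : a ≤ b) (hb : b < T) : sewApprox P D m s t a b * P b b = sewApprox P D m s t a b := by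
  induction m generalizing s t a with
  | zero => simp [sewApprox]
  | succ m ih =>
    rw [sewApprox]
    set d := max a (min ((s + t) / 2) b)
    have had : a ≤ d := le_max_left _ _
    have hdb : d ≤ b := max_le hab (min_le_right _ _)
    rw [add_mul, add_mul, h.D_mul_P a d b ha had hdb hb, mul_assoc, mul_assoc,
      ← h.mul d b b (by linarith) hdb le_rfl hb, ih _ _ (by linarith) hdb]

theorem sewApprox_succ_of_mem (m : ℕ) {s t a b : ℝ} (h1 : a ≤ (s + t) / 2) (h2 : (s + t) / 2 ≤ b) :
    sewApprox P D (m + 1) s t a b = D a ((s + t) / 2) b +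
      P a ((s + t) / 2) * sewApprox P D m ((s + t) / 2) t ((s + t) / 2) b +
      sewApprox P D m s ((s + t) / 2) a ((s + t) / 2) * P ((s + t) / 2) b := by
  rw [sewApprox, min_eq_left h2, max_eq_right h1]

theorem sewApprox_succ_of_le (h : IsCocycle T M K θ P D) (m : ℕ) {s t a b : ℝ} (ha : 0 ≤ a)
    (hab : a ≤ b) (hb : b < T) (hc : (s + t) / 2 ≤ a) :
    sewApprox P D (m + 1) s t a b = sewApprox P D m ((s + t) / 2) t a b := by
  rw [sewApprox, max_eq_left ((min_le_left _ _).trans hc), h.left a b ha hab hb,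
    h.sewApprox_self m _ _ ha (by linarith), h.unit_mul_sewApprox m _ _ ha hab hb]
  simp

theorem sewApprox_succ_of_ge (h : IsCocycle T M K θ P D) (m : ℕ) {s t a b : ℝ} (ha : 0 ≤ a)
    (hab : a ≤ b) (hb : b < T) (hc : b ≤ (s + t) / 2) :
    sewApprox P D (m + 1) s t a b = sewApprox P D m s ((s + t) / 2) a b := by
  rw [sewApprox, min_eq_right hc, max_eq_right hab, h.right a b ha hab hb,
    h.sewApprox_self m _ _ (by linarith) hb, h.sewApprox_mul_unit m _ _ ha hab hb]
  simp

theorem ratio_lt_one (h : IsCocycle T M K θ P D) : 2 * (1 / 2 : ℝ) ^ θ < 1 := by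
  have h := Real.rpow_lt_rpow_of_exponent_gt (x := 1 / 2) (by norm_num) (by norm_num) h.one_lt
  rw [Real.rpow_one] at h
  linarith

theorem norm_sandwich_D_le (h : IsCocycle T M K θ P D) {x a c b y l : ℝ} (hx : 0 ≤ x) (hxa : x ≤ a)
    (hac : a ≤ c) (hcb : c ≤ b) (hby : b ≤ y) (hy : y < T) (hl : b - a ≤ l) :
    ‖P x a * D a c b * P b y‖ ≤ M * M * K * l ^ θ := by
  have h1 := h.norm_P_le x a hx hxa (by linarith)
  have h2 := h.norm_P_le b y (by linarith) hby hy
  have h3 := h.norm_D_le a c b (by linarith) hac hcb (by linarith)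
  have hK := h.nonneg_K
  have hM := h.nonneg_M
  have h4 : (b - a) ^ θ ≤ l ^ θ :=
    Real.rpow_le_rpow (by linarith) hl (by linarith [h.one_lt])
  calc ‖P x a * D a c b * P b y‖ ≤ ‖P x a‖ * ‖D a c b‖ * ‖P b y‖ := norm_mul₃_le
    _ ≤ M * (K * l ^ θ) * M := by
      have h5 := h3.trans (mul_le_mul_of_nonneg_left h4 hK)
      have h6 := (norm_nonneg _).trans h5
      gcongr
    _ = _ := by ring

theorem half_rpow {s t θ : ℝ} (hst : s ≤ t) :
    (t - (s + t) / 2) ^ θ = (1 / 2) ^ θ * (t - s) ^ θ ∧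
    ((s + t) / 2 - s) ^ θ = (1 / 2) ^ θ * (t - s) ^ θ := by
  rw [← Real.mul_rpow (by norm_num) (by linarith)]
  constructor <;> congr 1 <;> ring

theorem norm_sandwich_sewApprox_succ_sub_le (h : IsCocycle T M K θ P D) (m : ℕ)
    {s t x a b y : ℝ} (hx : 0 ≤ x) (hxa : x ≤ a) (hab : a ≤ b) (hby : b ≤ y) (hy : y < T)
    (hsa : s ≤ a) (hbt : b ≤ t) :
    ‖P x a * (sewApprox P D (m + 1) s t a b - sewApprox P D m s t a b) * P b y‖ ≤
      M * M * K * (t - s) ^ θ * (2 * (1 / 2) ^ θ) ^ m := by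
  have hM := h.nonneg_M
  have hK := h.nonneg_K
  induction m generalizing s t x a b y with
  | zero =>
    have e : sewApprox P D (0 + 1) s t a b - sewApprox P D 0 s t a b =
        D a (max a (min ((s + t) / 2) b)) b := by simp [sewApprox]
    rw [e, pow_zero, mul_one]
    exact h.norm_sandwich_D_le hx hxa (le_max_left _ _) (max_le hab (min_le_right _ _)) hby hy
      (by linarith)
  | succ m ih =>
    obtain ⟨r1, r2⟩ := half_rpow (θ := θ) (hsa.trans (hab.trans hbt))
    have hpos : 0 ≤ (t - s) ^ θ := Real.rpow_nonneg (by linarith) _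
    have hhalf : M * M * K * ((1 / 2) ^ θ * (t - s) ^ θ) * (2 * (1 / 2) ^ θ) ^ m ≤
        M * M * K * (t - s) ^ θ * (2 * (1 / 2) ^ θ) ^ (m + 1) := by
      rw [pow_succ]
      have : 0 ≤ M * M * K * ((1 / 2) ^ θ * (t - s) ^ θ) * (2 * (1 / 2) ^ θ) ^ m := by positivity
      linarith
    rcases le_total ((s + t) / 2) a with hc | hc
    · rw [h.sewApprox_succ_of_le (m + 1) (by linarith) hab (by linarith) hc,
        h.sewApprox_succ_of_le m (by linarith) hab (by linarith) hc]
      refine (ih hx hxa hab hby hy hc hbt).trans ?_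
      rwa [r1]
    rcases le_total b ((s + t) / 2) with hc' | hc'
    · rw [h.sewApprox_succ_of_ge (m + 1) (by linarith) hab (by linarith) hc',
        h.sewApprox_succ_of_ge m (by linarith) hab (by linarith) hc']
      refine (ih hx hxa hab hby hy hsa hc').trans ?_
      rwa [r2]
    rw [sewApprox_succ_of_mem (m + 1) hc hc', sewApprox_succ_of_mem m hc hc']
    have i1 := ih (s := (s + t) / 2) (t := t) hx (hxa.trans hc) hc' hby hy le_rfl hbt
    have i2 := ih (s := s) (t := (s + t) / 2) hx hxa hc (hc'.trans hby) hy hsa le_rfl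
    rw [r1] at i1
    rw [r2] at i2
    rw [h.mul x a _ hx hxa hc (by linarith)] at i1
    rw [h.mul _ b y (by linarith) hc' hby hy] at i2
    refine (le_of_eq (congrArg _ ?_)).trans ((norm_add_le _ _).trans
      ((add_le_add i1 i2).trans_eq ?_))
    · noncomm_ring
    · ring

theorem norm_sandwich_sewApprox_le (h : IsCocycle T M K θ P D) (m : ℕ)
    {s t x a b y : ℝ} (hx : 0 ≤ x) (hxa : x ≤ a) (hab : a ≤ b) (hby : b ≤ y) (hy : y < T)
    (hsa : s ≤ a) (hbt : b ≤ t) :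
    ‖P x a * sewApprox P D m s t a b * P b y‖ ≤
      M * M * K / (1 - 2 * (1 / 2) ^ θ) * (t - s) ^ θ := by
  have hpos : 0 ≤ (t - s) ^ θ := Real.rpow_nonneg (by linarith) _
  have hq := h.ratio_lt_one
  have hq' : 0 ≤ M * M * K / (1 - 2 * (1 / 2) ^ θ) :=
    div_nonneg (mul_nonneg (mul_nonneg h.nonneg_M h.nonneg_M) h.nonneg_K) (by linarith)
  have hgeom : ∀ m : ℕ, M * M * K * (t - s) ^ θ * ∑ j ∈ Finset.range m, (2 * (1 / 2) ^ θ) ^ j ≤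
      M * M * K / (1 - 2 * (1 / 2) ^ θ) * (t - s) ^ θ := fun m ↦ by
    have h0 : (0 : ℝ) ≤ 2 * (1 / 2) ^ θ := by positivity
    have h1 := (summable_geometric_of_lt_one h0 hq).sum_le_tsum (Finset.range m)
      fun j _ ↦ pow_nonneg h0 j
    rw [tsum_geometric_of_lt_one h0 hq] at h1
    have h2 : 0 ≤ M * M * K * (t - s) ^ θ :=
      mul_nonneg (mul_nonneg (mul_nonneg h.nonneg_M h.nonneg_M) h.nonneg_K) hpos
    refine (mul_le_mul_of_nonneg_left h1 h2).trans_eq ?_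
    rw [div_eq_mul_inv]
    ring
  refine le_trans ?_ (hgeom m)
  clear hgeom
  induction m with
  | zero => simp [sewApprox]
  | succ m ih =>
    have h1 := h.norm_sandwich_sewApprox_succ_sub_le m hx hxa hab hby hy hsa hbt
    rw [mul_sub, sub_mul] at h1
    rw [Finset.sum_range_succ, mul_add]
    linarith [norm_sub_norm_le (P x a * sewApprox P D (m + 1) s t a b * P b y)
      (P x a * sewApprox P D m s t a b * P b y)]

theorem norm_sewApprox_le_cell (h : IsCocycle T M K θ P D) (m : ℕ)
    {s t a b : ℝ} (ha : 0 ≤ a) (hab : a ≤ b) (hb : b < T) (hsa : s ≤ a) (hbt : b ≤ t) :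
    ‖sewApprox P D m s t a b‖ ≤ M * M * K / (1 - 2 * (1 / 2) ^ θ) * (t - s) ^ θ := by
  have := h.norm_sandwich_sewApprox_le m ha le_rfl hab le_rfl hb hsa hbt
  rwa [h.unit_mul_sewApprox m s t ha hab hb, h.sewApprox_mul_unit m s t ha hab hb] at this

theorem norm_sewApprox_succ_sub_le (h : IsCocycle T M K θ P D) (m : ℕ)
    {s t a b : ℝ} (ha : 0 ≤ a) (hab : a ≤ b) (hb : b < T) (hsa : s ≤ a) (hbt : b ≤ t) :
    ‖sewApprox P D (m + 1) s t a b - sewApprox P D m s t a b‖ ≤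
      M * M * K * (t - s) ^ θ * (2 * (1 / 2) ^ θ) ^ m := by
  have := h.norm_sandwich_sewApprox_succ_sub_le m ha le_rfl hab le_rfl hb hsa hbt
  rwa [mul_sub, sub_mul, h.unit_mul_sewApprox m s t ha hab hb, h.sewApprox_mul_unit m s t ha hab hb,
    h.unit_mul_sewApprox (m + 1) s t ha hab hb, h.sewApprox_mul_unit (m + 1) s t ha hab hb] at this

theorem exists_norm_sewApprox_le (h : IsCocycle T M K θ P D) :
    ∃ C : ℝ, 0 ≤ C ∧ ∀ (m : ℕ) (s t a b : ℝ), 0 ≤ a → a ≤ b → b < T → s ≤ a → b ≤ t →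
      ‖sewApprox P D m s t a b‖ ≤ C * (b - a) ^ θ := by
  set C₀ := M * M * K / (1 - 2 * (1 / 2) ^ θ) with hC₀
  have hM := h.nonneg_M
  have hK := h.nonneg_K
  have h0 : 0 ≤ C₀ := div_nonneg (mul_nonneg (mul_nonneg h.nonneg_M h.nonneg_M) h.nonneg_K)
    (by linarith [h.ratio_lt_one])
  have hθ : 0 ≤ θ := by linarith [h.one_lt]
  have crude : ∀ l l' : ℝ, 0 ≤ l → l ≤ 2 * l' → C₀ * l ^ θ ≤ C₀ * 2 ^ θ * l' ^ θ := by
    intro l l' hl hl'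
    rw [mul_assoc, ← Real.mul_rpow (by norm_num) (by linarith)]
    gcongr
  have hright : ∀ (m : ℕ) (s t a : ℝ), 0 ≤ a → a ≤ t → t < T → s ≤ a →
      ‖sewApprox P D m s t a t‖ ≤ C₀ * 2 ^ θ * (t - a) ^ θ := by
    intro m
    induction m with
    | zero =>
      intro s t a ha hat ht hsa
      have : 0 ≤ (t - a) ^ θ := Real.rpow_nonneg (by linarith) _
      rw [sewApprox, norm_zero]
      positivity
    | succ m ih =>
      intro s t a ha hat ht hsa
      rcases le_total ((s + t) / 2) a with hc | hc
      · rw [h.sewApprox_succ_of_le m ha hat ht hc]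
        exact ih _ _ _ ha hat ht hc
      · exact (h.norm_sewApprox_le_cell (m + 1) ha hat ht hsa le_rfl).trans
          (crude _ _ (by linarith) (by linarith))
  have hleft : ∀ (m : ℕ) (s t b : ℝ), 0 ≤ s → s ≤ b → b < T → b ≤ t →
      ‖sewApprox P D m s t s b‖ ≤ C₀ * 2 ^ θ * (b - s) ^ θ := by
    intro m
    induction m with
    | zero =>
      intro s t b hs hsb hb hbt
      have : 0 ≤ (b - s) ^ θ := Real.rpow_nonneg (by linarith) _
      rw [sewApprox, norm_zero]
      positivity
    | succ m ih =>
      intro s t b hs hsb hb hbt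
      rcases le_total b ((s + t) / 2) with hc | hc
      · rw [h.sewApprox_succ_of_ge m hs hsb hb hc]
        exact ih _ _ _ hs hsb hb hc
      · exact (h.norm_sewApprox_le_cell (m + 1) hs hsb hb le_rfl hbt).trans
          (crude _ _ (by linarith) (by linarith))
  refine ⟨K + M * (C₀ * 2 ^ θ) + C₀ * 2 ^ θ * M, by positivity, fun m ↦ ?_⟩
  induction m with
  | zero =>
    intro s t a b ha hab hb hsa hbt
    have : 0 ≤ (b - a) ^ θ := Real.rpow_nonneg (by linarith) _
    rw [sewApprox, norm_zero]
    positivity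
  | succ m ih =>
    intro s t a b ha hab hb hsa hbt
    rcases le_total ((s + t) / 2) a with hc | hc
    · rw [h.sewApprox_succ_of_le m ha hab hb hc]
      exact ih _ _ _ _ ha hab hb hc hbt
    rcases le_total b ((s + t) / 2) with hc' | hc'
    · rw [h.sewApprox_succ_of_ge m ha hab hb hc']
      exact ih _ _ _ _ ha hab hb hsa hc'
    rw [sewApprox_succ_of_mem m hc hc']
    set c := (s + t) / 2
    have b1 := h.norm_D_le a c b ha hc hc' hb
    have b2 := h.norm_P_le a c ha hc (by linarith)
    have b3 := h.norm_P_le c b (by linarith) hc' hb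
    have b4 : ‖sewApprox P D m c t c b‖ ≤ C₀ * 2 ^ θ * (b - a) ^ θ :=
      (hleft m c t b (by linarith) hc' hb hbt).trans
        (mul_le_mul_of_nonneg_left (Real.rpow_le_rpow (by linarith) (by linarith) hθ)
          (by positivity))
    have b5 : ‖sewApprox P D m s c a c‖ ≤ C₀ * 2 ^ θ * (b - a) ^ θ :=
      (hright m s c a ha hc (by linarith) hsa).trans
        (mul_le_mul_of_nonneg_left (Real.rpow_le_rpow (by linarith) (by linarith) hθ)
          (by positivity))
    have hpos : 0 ≤ (b - a) ^ θ := Real.rpow_nonneg (by linarith) _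
    calc _ ≤ ‖D a c b‖ + ‖P a c‖ * ‖sewApprox P D m c t c b‖ +
          ‖sewApprox P D m s c a c‖ * ‖P c b‖ :=
        norm_add₃_le.trans (add_le_add (add_le_add le_rfl (norm_mul_le _ _)) (norm_mul_le _ _))
      _ ≤ K * (b - a) ^ θ + M * (C₀ * 2 ^ θ * (b - a) ^ θ) +
          C₀ * 2 ^ θ * (b - a) ^ θ * M := by gcongr
      _ = _ := by ring

/-- The defect of `sewApprox` in the relation that its limit satisfies. -/
theorem norm_sandwich_defect_le (h : IsCocycle T M K θ P D) (m : ℕ)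
    {s t x a c b y : ℝ} (hx : 0 ≤ x) (hxa : x ≤ a) (hac : a ≤ c) (hcb : c ≤ b) (hby : b ≤ y)
    (hy : y < T) (hsa : s ≤ a) (hbt : b ≤ t) :
    ‖P x a * (sewApprox P D m s t a b - (P a c * sewApprox P D m s t c b +
      sewApprox P D m s t a c * P c b + D a c b)) * P b y‖ ≤
      M * M * K * (t - s) ^ θ * ((1 / 2) ^ θ) ^ m := by
  induction m generalizing s t x a b y with
  | zero =>
    have e : sewApprox P D 0 s t a b - (P a c * sewApprox P D 0 s t c b +
      sewApprox P D 0 s t a c * P c b + D a c b) = - D a c b := by simp [sewApprox]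
    rw [e, pow_zero, mul_one, mul_neg, neg_mul, norm_neg]
    exact h.norm_sandwich_D_le hx hxa hac hcb hby hy (by linarith)
  | succ m ih =>
    obtain ⟨r1, r2⟩ := half_rpow (θ := θ) (hsa.trans (hac.trans (hcb.trans hbt)))
    have ha : 0 ≤ a := hx.trans hxa
    have hc : 0 ≤ c := ha.trans hac
    have hb : b < T := hby.trans_lt hy
    have hcT : c < T := hcb.trans_lt hb
    have hhalf : M * M * K * ((1 / 2) ^ θ * (t - s) ^ θ) * ((1 / 2) ^ θ) ^ m =
        M * M * K * (t - s) ^ θ * ((1 / 2) ^ θ) ^ (m + 1) := by ring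
    rcases le_total ((s + t) / 2) a with h1 | h1
    · rw [h.sewApprox_succ_of_le m ha (hac.trans hcb) hb h1,
        h.sewApprox_succ_of_le m hc hcb hb (h1.trans hac),
        h.sewApprox_succ_of_le m ha hac hcT h1]
      refine (ih hx hxa hac hcb hby hy h1 hbt).trans ?_
      rw [r1, hhalf]
    rcases le_total b ((s + t) / 2) with h2 | h2
    · rw [h.sewApprox_succ_of_ge m ha (hac.trans hcb) hb h2,
        h.sewApprox_succ_of_ge m hc hcb hb h2,
        h.sewApprox_succ_of_ge m ha hac hcT (hcb.trans h2)]
      refine (ih hx hxa hac hcb hby hy hsa h2).trans ?_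
      rw [r2, hhalf]
    have hd : 0 ≤ (s + t) / 2 := ha.trans h1
    rcases le_total c ((s + t) / 2) with h3 | h3
    · have i := ih hx hxa hac h3 (h2.trans hby) hy hsa le_rfl
      rw [sewApprox_succ_of_mem m h1 h2, sewApprox_succ_of_mem m h3 h2,
        h.sewApprox_succ_of_ge m ha hac hcT h3]
      rw [r2, hhalf, h.mul _ b y hd h2 hby hy] at i
      refine le_trans (le_of_eq (congrArg _ ?_)) i
      have e1 := h.cocycle a c ((s + t) / 2) b ha hac h3 h2 hb
      have e2 := h.mul a c ((s + t) / 2) ha hac h3 (by linarith)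
      have e3 := h.mul c ((s + t) / 2) b hc h3 h2 hb
      rw [← eq_sub_iff_add_eq'] at e1
      rw [e1, e2, e3]
      noncomm_ring
    · have i := ih hx (hxa.trans h1) h3 hcb hby hy le_rfl hbt
      rw [sewApprox_succ_of_mem m h1 h2, sewApprox_succ_of_mem m h1 h3,
        h.sewApprox_succ_of_le m hc hcb hb h3]
      rw [r1, hhalf, h.mul x a _ hx hxa h1 (by linarith)] at i
      refine le_trans (le_of_eq (congrArg _ ?_)) i
      have e1 := h.cocycle a ((s + t) / 2) c b ha h1 h3 hcb hb
      have e2 := h.mul a ((s + t) / 2) c ha h1 h3 (by linarith)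
      have e3 := h.mul ((s + t) / 2) c b hd h3 hcb hb
      rw [← eq_sub_iff_add_eq'] at e1
      rw [e1, e2, e3]
      noncomm_ring

/-- The sewing lemma along a bounded multiplicative function. -/
theorem exists_sewing [CompleteSpace R] (h : IsCocycle T M K θ P D) (V : AddSubgroup R)
    (hV : IsClosed (V : Set R))
    (hD : ∀ a c b : ℝ, 0 ≤ a → a ≤ c → c ≤ b → b < T → D a c b ∈ V)
    (hPV : ∀ a b : ℝ, 0 ≤ a → a ≤ b → b < T → ∀ v ∈ V, P a b * v ∈ V)
    (hVP : ∀ a b : ℝ, 0 ≤ a → a ≤ b → b < T → ∀ v ∈ V, v * P a b ∈ V) :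
    ∃ (B : ℝ → ℝ → R) (C : ℝ),
      (∀ a c b : ℝ, 0 ≤ a → a ≤ c → c ≤ b → b < T →
        B a b = P a c * B c b + B a c * P c b + D a c b) ∧
      (∀ a b : ℝ, 0 ≤ a → a ≤ b → b < T → ‖B a b‖ ≤ C * (b - a) ^ θ) ∧
      ∀ a b : ℝ, 0 ≤ a → a ≤ b → b < T → B a b ∈ V := by
  obtain ⟨C, -, hC⟩ := h.exists_norm_sewApprox_le
  have hlim : ∀ a b : ℝ, 0 ≤ a → a ≤ b → b < T →
      Filter.Tendsto (fun m ↦ sewApprox P D m 0 T a b) Filter.atTop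
        (nhds (Filter.limUnder Filter.atTop fun m ↦ sewApprox P D m 0 T a b)) := by
    intro a b ha hab hb
    refine (cauchySeq_of_le_geometric _ (M * M * K * (T - 0) ^ θ)
      h.ratio_lt_one fun m ↦ ?_).tendsto_limUnder
    rw [dist_comm, dist_eq_norm]
    exact h.norm_sewApprox_succ_sub_le m ha hab hb ha hb.le
  refine ⟨fun a b ↦ Filter.limUnder Filter.atTop fun m ↦ sewApprox P D m 0 T a b, C, ?_, ?_, ?_⟩
  · intro a c b ha hac hcb hb
    have hab := hac.trans hcb
    have l1 := (hlim a b ha hab hb).sub ((((hlim c b (ha.trans hac) hcb hb).const_mul (P a c)).add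
      ((hlim a c ha hac (hcb.trans_lt hb)).mul_const (P c b))).add_const (D a c b))
    have l2 := ((l1.const_mul (P a a)).mul_const (P b b)).norm
    have h0 : (0 : ℝ) ≤ (1 / 2) ^ θ := by positivity
    have hr : (1 / 2 : ℝ) ^ θ < 1 :=
      Real.rpow_lt_one (by norm_num) (by norm_num) (by linarith [h.one_lt])
    have l3 := (tendsto_pow_atTop_nhds_zero_of_lt_one h0 hr).const_mul (M * M * K * (T - 0) ^ θ)
    rw [mul_zero] at l3
    have l4 := le_of_tendsto_of_tendsto' l2 l3 fun m ↦
      h.norm_sandwich_defect_le m ha le_rfl hac hcb le_rfl hb ha hb.le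
    have l5 := norm_le_zero_iff.1 l4
    refine sub_eq_zero.1 (Eq.trans ?_ l5)
    refine tendsto_nhds_unique l1 (((l1.const_mul (P a a)).mul_const (P b b)).congr fun m ↦ ?_)
    have u1 := h.unit_mul_sewApprox m 0 T ha hab hb
    have u2 := h.sewApprox_mul_unit m 0 T ha hab hb
    have u3 := h.sewApprox_mul_unit m 0 T (ha.trans hac) hcb hb
    have u4 := h.unit_mul_sewApprox m 0 T ha hac (hcb.trans_lt hb)
    have u5 := h.mul a a c ha le_rfl hac (hcb.trans_lt hb)
    have u6 := h.mul c b b (ha.trans hac) hcb le_rfl hb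
    simp only [mul_sub, sub_mul, mul_add, add_mul]
    rw [u1, u2, ← mul_assoc, ← u5, mul_assoc, u3, ← mul_assoc (P a a), u4, mul_assoc, ← u6,
      h.P_mul_D a c b ha hac hcb hb, h.D_mul_P a c b ha hac hcb hb]
  · intro a b ha hab hb
    exact le_of_tendsto' (hlim a b ha hab hb).norm fun m ↦ hC m 0 T a b ha hab hb ha hb.le
  · intro a b ha hab hb
    refine hV.mem_of_tendsto (hlim a b ha hab hb) (Filter.Eventually.of_forall fun m ↦ ?_)
    have : ∀ (m : ℕ) (s t a b : ℝ), 0 ≤ a → a ≤ b → b < T → sewApprox P D m s t a b ∈ V := by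
      intro m
      induction m with
      | zero => exact fun _ _ _ _ _ _ _ ↦ V.zero_mem
      | succ m ih =>
        intro s t a b ha hab hb
        rw [sewApprox]
        set d := max a (min ((s + t) / 2) b)
        have had : a ≤ d := le_max_left _ _
        have hdb : d ≤ b := max_le hab (min_le_right _ _)
        exact V.add_mem (V.add_mem (hD a d b ha had hdb hb)
          (hPV a d ha had (by linarith) _ (ih _ _ _ _ (by linarith) hdb hb)))
          (hVP d b (by linarith) hdb hb _ (ih _ _ _ _ ha had (by linarith)))
    exact this m 0 T a b ha hab hb

end IsCocycle

end Sewing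

section Extension

variable {R : Type*} [NormedRing R]

theorem sum_antidiagonal_succ_mul (f g : ℕ → R) (n : ℕ) :
    ∑ p ∈ Finset.HasAntidiagonal.antidiagonal (n + 1), f p.1 * g p.2 =
      f 0 * g (n + 1) + f (n + 1) * g 0 + ∑ i ∈ Finset.range n, f (i + 1) * g (n - i) := by
  rw [Finset.Nat.sum_antidiagonal_eq_sum_range_succ_mk, Finset.sum_range_succ,
    Finset.sum_range_succ']
  simp only [Nat.add_sub_add_right, Nat.sub_zero, Nat.sub_self]
  abel

/-- A multiplicative functional of degree `n`, with the regularity `α`, valued in the graded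
pieces `L`. -/
structure IsMultiplicativeFunctional (T α : ℝ) (L : ℕ → AddSubgroup R) (n : ℕ)
    (A : ℕ → ℝ → ℝ → R) : Prop where
  chen : ∀ k ≤ n, ChenRelation T A k
  mem : ∀ k ≤ n, ∀ a b : ℝ, 0 ≤ a → a ≤ b → b < T → A k a b ∈ L k
  norm_le : ∀ k ≤ n, ∃ c : ℝ, ∀ a b : ℝ, 0 ≤ a → a ≤ b → b < T →
    ‖A k a b‖ ≤ c * (b - a) ^ ((k : ℝ) * α)

namespace IsMultiplicativeFunctional

variable {T α : ℝ} {L : ℕ → AddSubgroup R} {n : ℕ} {A : ℕ → ℝ → ℝ → R}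

theorem apply_self (h : IsMultiplicativeFunctional T α L n A) (hα : 0 < α) {k : ℕ} (hk : k ≤ n)
    (hk0 : k ≠ 0) {a : ℝ} (ha : 0 ≤ a) (haT : a < T) : A k a a = 0 := by
  obtain ⟨c, hc⟩ := h.norm_le k hk
  have := hc a a ha le_rfl haT
  rw [sub_self, Real.zero_rpow (by positivity), mul_zero] at this
  exact norm_le_zero_iff.1 this

theorem unit_mul (h : IsMultiplicativeFunctional T α L n A) (hα : 0 < α) {k : ℕ} (hk : k ≤ n)
    {a b : ℝ} (ha : 0 ≤ a) (hab : a ≤ b) (hb : b < T) : A 0 a a * A k a b = A k a b := by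
  rw [h.chen k hk a a b ha le_rfl hab hb]
  conv_lhs => rw [← h.chen k hk a a b ha le_rfl hab hb]
  symm
  refine Finset.sum_eq_single (0, k) (fun p hp hp0 ↦ ?_) (by simp)
  rw [Finset.HasAntidiagonal.mem_antidiagonal] at hp
  have h0 : p.1 ≠ 0 := fun h0 ↦ hp0 (Prod.ext h0 (by simpa [h0] using hp))
  rw [h.apply_self hα (by lia) h0 ha (by linarith), zero_mul]

theorem mul_unit (h : IsMultiplicativeFunctional T α L n A) (hα : 0 < α) {k : ℕ} (hk : k ≤ n)
    {a b : ℝ} (ha : 0 ≤ a) (hab : a ≤ b) (hb : b < T) : A k a b * A 0 b b = A k a b := by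
  rw [h.chen k hk a b b ha hab le_rfl hb]
  conv_lhs => rw [← h.chen k hk a b b ha hab le_rfl hb]
  symm
  refine Finset.sum_eq_single (k, 0) (fun p hp hp0 ↦ ?_) (by simp)
  rw [Finset.HasAntidiagonal.mem_antidiagonal] at hp
  have h0 : p.2 ≠ 0 := fun h0 ↦ hp0 (Prod.ext (by simpa [h0] using hp) h0)
  rw [h.apply_self hα (by lia) h0 (by linarith) hb, mul_zero]

theorem isMultiplicative_zero (h : IsMultiplicativeFunctional T α L n A) :
    IsMultiplicative T (A 0) := fun a c b ha hac hcb hb ↦ by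
  rw [h.chen 0 n.zero_le a c b ha hac hcb hb]
  simp

theorem cocycle (h : IsMultiplicativeFunctional T α L n A) {a c d b : ℝ} (ha : 0 ≤ a)
    (hac : a ≤ c) (hcd : c ≤ d) (hdb : d ≤ b) (hb : b < T) :
    A 0 a c * (∑ i ∈ Finset.range n, A (i + 1) c d * A (n - i) d b) +
        ∑ i ∈ Finset.range n, A (i + 1) a c * A (n - i) c b =
      (∑ i ∈ Finset.range n, A (i + 1) a c * A (n - i) c d) * A 0 d b +
        ∑ i ∈ Finset.range n, A (i + 1) a d * A (n - i) d b := by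
  let g : ℝ → ℝ → PowerSeries R := fun a b ↦ PowerSeries.mk fun k ↦ if k ≤ n then A k a b else 0
  have g1 : ∀ k ≤ n, ∀ a b, PowerSeries.coeff k (g a b) = A k a b := fun k hk a b ↦ by
    simp [g, hk]
  have g2 : ∀ a b, PowerSeries.coeff (n + 1) (g a b) = 0 := fun a b ↦ by simp [g]
  have m1 : ∀ k ≤ n, ∀ a c b, 0 ≤ a → a ≤ c → c ≤ b → b < T →
      PowerSeries.coeff k (g a c * g c b) = A k a b := by
    intro k hk a c b ha hac hcb hb
    rw [PowerSeries.coeff_mul, h.chen k hk a c b ha hac hcb hb]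
    refine Finset.sum_congr rfl fun p hp ↦ ?_
    rw [Finset.HasAntidiagonal.mem_antidiagonal] at hp
    rw [g1 _ (by lia), g1 _ (by lia)]
  have split : ∀ φ ψ : PowerSeries R, PowerSeries.coeff (n + 1) (φ * ψ) =
      PowerSeries.coeff 0 φ * PowerSeries.coeff (n + 1) ψ +
      PowerSeries.coeff (n + 1) φ * PowerSeries.coeff 0 ψ +
      ∑ i ∈ Finset.range n, PowerSeries.coeff (i + 1) φ * PowerSeries.coeff (n - i) ψ :=
    fun φ ψ ↦ by
      rw [PowerSeries.coeff_mul]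
      exact sum_antidiagonal_succ_mul (fun k ↦ PowerSeries.coeff k φ)
        (fun k ↦ PowerSeries.coeff k ψ) n
  have m2 : ∀ a c b, PowerSeries.coeff (n + 1) (g a c * g c b) =
      ∑ i ∈ Finset.range n, A (i + 1) a c * A (n - i) c b := by
    intro a c b
    rw [split, g2, g2, mul_zero, zero_mul, add_zero, zero_add]
    refine Finset.sum_congr rfl fun i hi ↦ ?_
    rw [Finset.mem_range] at hi
    rw [g1 _ (by lia), g1 _ (by lia)]
  have e1 : PowerSeries.coeff (n + 1) (g a c * (g c d * g d b)) =
      A 0 a c * (∑ i ∈ Finset.range n, A (i + 1) c d * A (n - i) d b) +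
        ∑ i ∈ Finset.range n, A (i + 1) a c * A (n - i) c b := by
    rw [split, g2, zero_mul, add_zero, m2, g1 0 n.zero_le]
    congr 1
    refine Finset.sum_congr rfl fun i hi ↦ ?_
    rw [Finset.mem_range] at hi
    rw [g1 _ (by lia), m1 _ (by lia) c d b (by linarith) hcd hdb hb]
  have e2 : PowerSeries.coeff (n + 1) (g a c * g c d * g d b) =
      (∑ i ∈ Finset.range n, A (i + 1) a c * A (n - i) c d) * A 0 d b +
        ∑ i ∈ Finset.range n, A (i + 1) a d * A (n - i) d b := by
    rw [split, g2, mul_zero, zero_add, m2, g1 0 n.zero_le]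
    congr 1
    refine Finset.sum_congr rfl fun i hi ↦ ?_
    rw [Finset.mem_range] at hi
    rw [g1 (n - i) (by lia), m1 _ (by lia) a c d ha hac hcd (by linarith)]
  rw [← e1, ← e2, mul_assoc]

theorem exists_succ [CompleteSpace R] (h : IsMultiplicativeFunctional T α L n A) (hα : 0 < α)
    (hn : 1 < ((n + 1 : ℕ) : ℝ) * α) (hLc : ∀ k, IsClosed (L k : Set R))
    (hL : ∀ i j, ∀ x ∈ L i, ∀ y ∈ L j, x * y ∈ L (i + j)) :
    ∃ A' : ℕ → ℝ → ℝ → R, IsMultiplicativeFunctional T α L (n + 1) A' ∧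
      ∀ k ≤ n, A' k = A k := by
  have hc := h.norm_le
  choose! c hc using hc
  have hc' : ∀ k ≤ n, ∀ a b : ℝ, 0 ≤ a → a ≤ b → b < T →
      ‖A k a b‖ ≤ |c k| * (b - a) ^ ((k : ℝ) * α) := fun k hk a b ha hab hb ↦
    (hc k hk a b ha hab hb).trans
      (mul_le_mul_of_nonneg_right (le_abs_self _) (Real.rpow_nonneg (by linarith) _))
  have hD : IsCocycle T |c 0| (∑ i ∈ Finset.range n, |c (i + 1)| * |c (n - i)|)
      (((n + 1 : ℕ) : ℝ) * α) (A 0)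
      (fun a c b ↦ ∑ i ∈ Finset.range n, A (i + 1) a c * A (n - i) c b) := by
    refine ⟨hn, abs_nonneg _, by positivity, h.isMultiplicative_zero, ?_, ?_, ?_, ?_, ?_, ?_, ?_⟩
    · intro a b ha hab hb
      simpa using hc' 0 n.zero_le a b ha hab hb
    · intro a d b ha had hdb hb
      rw [Finset.sum_mul]
      refine (norm_sum_le _ _).trans (Finset.sum_le_sum fun i hi ↦ ?_)
      rw [Finset.mem_range] at hi
      have hb0 : 0 ≤ b - a := by linarith
      have h1 := (hc' (i + 1) (by lia) a d ha had (by linarith)).trans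
        (mul_le_mul_of_nonneg_left (Real.rpow_le_rpow (by linarith)
          (by linarith : d - a ≤ b - a) (by positivity)) (abs_nonneg _))
      have h2 := (hc' (n - i) (by lia) d b (by linarith) hdb hb).trans
        (mul_le_mul_of_nonneg_left (Real.rpow_le_rpow (by linarith)
          (by linarith : b - d ≤ b - a) (by positivity)) (abs_nonneg _))
      have e : (b - a) ^ (((n + 1 : ℕ) : ℝ) * α) =
          (b - a) ^ (((i + 1 : ℕ) : ℝ) * α) * (b - a) ^ (((n - i : ℕ) : ℝ) * α) := by
        rw [← Real.rpow_add_of_nonneg hb0 (by positivity) (by positivity), ← add_mul,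
          ← Nat.cast_add, show i + 1 + (n - i) = n + 1 by lia]
      rw [e]
      refine (norm_mul_le _ _).trans ((mul_le_mul h1 h2 (norm_nonneg _)
        ((norm_nonneg _).trans h1)).trans_eq (by ring))
    · intro a b ha hab hb
      refine Finset.sum_eq_zero fun i hi ↦ ?_
      rw [Finset.mem_range] at hi
      rw [h.apply_self hα (by lia) (by lia) ha (by linarith), zero_mul]
    · intro a b ha hab hb
      refine Finset.sum_eq_zero fun i hi ↦ ?_
      rw [Finset.mem_range] at hi
      rw [h.apply_self hα (k := n - i) (by lia) (by lia) (by linarith) hb, mul_zero]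
    · intro a d b ha had hdb hb
      rw [Finset.mul_sum]
      refine Finset.sum_congr rfl fun i hi ↦ ?_
      rw [Finset.mem_range] at hi
      rw [← mul_assoc, h.unit_mul hα (by lia) ha had (by linarith)]
    · intro a d b ha had hdb hb
      rw [Finset.sum_mul]
      refine Finset.sum_congr rfl fun i hi ↦ ?_
      rw [Finset.mem_range] at hi
      rw [mul_assoc, h.mul_unit hα (by lia) (by linarith) hdb hb]
    · intro a d e b ha had hde heb hb
      exact h.cocycle ha had hde heb hb
  obtain ⟨B, C, hB, hBC, hBL⟩ := hD.exists_sewing (L (n + 1)) (hLc _)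
    (fun a d b ha had hdb hb ↦ AddSubgroup.sum_mem _ fun i hi ↦ by
      rw [Finset.mem_range] at hi
      have := hL _ _ _ (h.mem (i + 1) (by lia) a d ha had (by linarith)) _
        (h.mem (n - i) (by lia) d b (by linarith) hdb hb)
      rwa [show i + 1 + (n - i) = n + 1 by lia] at this)
    (fun a b ha hab hb v hv ↦ by
      have := hL _ _ _ (h.mem 0 n.zero_le a b ha hab hb) _ hv
      rwa [zero_add] at this)
    (fun a b ha hab hb v hv ↦ hL _ _ _ hv _ (h.mem 0 n.zero_le a b ha hab hb))
  have u1 : Function.update A (n + 1) B (n + 1) = B := Function.update_self ..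
  have u2 : ∀ k ≤ n, Function.update A (n + 1) B k = A k := fun k hk ↦
    Function.update_of_ne (by lia) _ _
  refine ⟨Function.update A (n + 1) B, ⟨?_, ?_, ?_⟩, u2⟩
  · intro k hk a d b ha had hdb hb
    rcases Nat.of_le_succ hk with hk | rfl
    · rw [u2 k hk, h.chen k hk a d b ha had hdb hb]
      refine Finset.sum_congr rfl fun p hp ↦ ?_
      rw [Finset.HasAntidiagonal.mem_antidiagonal] at hp
      rw [u2 _ (by lia), u2 _ (by lia)]
    · rw [sum_antidiagonal_succ_mul (fun k ↦ Function.update A (n + 1) B k a d)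
        (fun k ↦ Function.update A (n + 1) B k d b)]
      simp only [u1, u2 0 n.zero_le]
      rw [hB a d b ha had hdb hb]
      congr 1
      refine Finset.sum_congr rfl fun i hi ↦ ?_
      rw [Finset.mem_range] at hi
      rw [u2 _ (by lia), u2 _ (by lia)]
  · intro k hk
    rcases Nat.of_le_succ hk with hk | rfl
    · rw [u2 k hk]
      exact h.mem k hk
    · rw [u1]
      exact hBL
  · intro k hk
    rcases Nat.of_le_succ hk with hk | rfl
    · rw [u2 k hk]
      exact h.norm_le k hk
    · rw [u1]
      exact ⟨C, hBC⟩

theorem exists_extension [CompleteSpace R] (h : IsMultiplicativeFunctional T α L n A) (hα : 0 < α)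
    (hn : 1 < ((n : ℝ) + 1) * α) (hLc : ∀ k, IsClosed (L k : Set R))
    (hL : ∀ i j, ∀ x ∈ L i, ∀ y ∈ L j, x * y ∈ L (i + j)) :
    ∃ B : ℕ → ℝ → ℝ → R, (∀ N, IsMultiplicativeFunctional T α L N B) ∧ ∀ k ≤ n, B k = A k := by
  have step : ∀ j : ℕ, ∀ F : {F // IsMultiplicativeFunctional T α L (n + j) F},
      ∃ F' : {F // IsMultiplicativeFunctional T α L (n + (j + 1)) F},
        ∀ k ≤ n + j, F'.1 k = F.1 k := by
    rintro j ⟨F, hF⟩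
    obtain ⟨F', hF', hk⟩ := hF.exists_succ hα (hn.trans_le (by push_cast; gcongr; linarith)) hLc hL
    exact ⟨⟨F', hF'⟩, hk⟩
  choose next hnext using step
  let F : ∀ j : ℕ, {F // IsMultiplicativeFunctional T α L (n + j) F} := fun j ↦
    Nat.rec ⟨A, h⟩ (fun j F ↦ next j F) j
  have hF : ∀ j, ∀ k ≤ n + j, (F (j + 1)).1 k = (F j).1 k := fun j k hk ↦ hnext j (F j) k hk
  have hF' : ∀ j i, ∀ k ≤ n + j, (F (j + i)).1 k = (F j).1 k := by
    intro j i k hk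
    induction i with
    | zero => rfl
    | succ i ih => rw [← ih, ← hF (j + i) k (by lia), add_assoc]
  have hB : ∀ N, ∀ k ≤ N, (F k).1 k = (F N).1 k := fun N k hk ↦ by
    rw [← hF' k (N - k) k (by lia), Nat.add_sub_cancel' hk]
  refine ⟨fun k ↦ (F k).1 k, fun N ↦ ⟨?_, ?_, ?_⟩, ?_⟩
  · intro k hk a c b ha hac hcb hb
    change (F k).1 k a b = _
    rw [(F k).2.chen k (by lia) a c b ha hac hcb hb]
    refine Finset.sum_congr rfl fun p hp ↦ ?_
    rw [Finset.HasAntidiagonal.mem_antidiagonal] at hp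
    simp only [hB k p.1 (by lia), hB k p.2 (by lia)]
  · exact fun k _ ↦ (F k).2.mem k (by lia)
  · exact fun k _ ↦ (F k).2.norm_le k (by lia)
  · intro k hk
    have := hF' 0 k k (by lia)
    rwa [zero_add] at this

end IsMultiplicativeFunctional

end Extension

section Decay

variable {R : Type*} [NormedRing R]

/-- The weight `1 / (k!)^β`. -/
noncomputable def factorialWeight (β : ℝ) (k : ℕ) : ℝ := ((k.factorial : ℝ) ^ β)⁻¹

theorem factorialWeight_pos (β : ℝ) (k : ℕ) : 0 < factorialWeight β k :=
  inv_pos.2 (Real.rpow_pos_of_pos (by exact_mod_cast k.factorial_pos) _)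

theorem factorialWeight_mul_le {β : ℝ} (hβ : 0 ≤ β) (i j : ℕ) :
    factorialWeight β i * factorialWeight β j ≤
      ((2 : ℝ) ^ β) ^ (i + j) * factorialWeight β (i + j) := by
  unfold factorialWeight
  have h1 : ((i + j).factorial : ℝ) ≤ 2 ^ (i + j) * (i.factorial * j.factorial) := by
    have h2 : (i + j).factorial ≤ 2 ^ (i + j) * (i.factorial * j.factorial) := by
      rw [← Nat.add_choose_mul_factorial_mul_factorial i j, mul_assoc]
      exact Nat.mul_le_mul_right _ (Nat.choose_le_two_pow _ _)
    exact_mod_cast h2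
  have h3 := Real.rpow_le_rpow (by positivity) h1 hβ
  rw [Real.mul_rpow (by positivity) (by positivity),
    Real.mul_rpow (by positivity) (by positivity), ← Real.rpow_natCast, ← Real.rpow_mul (by simp),
    mul_comm ((i + j : ℕ) : ℝ), Real.rpow_mul (by simp), Real.rpow_natCast] at h3
  have p1 : 0 < ((i.factorial : ℝ)) ^ β := by positivity
  have p2 : 0 < ((j.factorial : ℝ)) ^ β := by positivity
  have p3 : 0 < (((i + j).factorial : ℝ)) ^ β := by positivity
  rw [← mul_inv, ← div_eq_mul_inv, inv_le_comm₀ (by positivity) (by positivity), inv_div,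
    div_le_iff₀ (by positivity)]
  linarith

theorem summable_pow_mul_factorialWeight {β : ℝ} (hβ : 0 < β) (x : ℝ) :
    Summable fun k ↦ x ^ k * factorialWeight β k := by
  rcases eq_or_ne x 0 with rfl | hx
  · refine summable_of_ne_finset_zero (s := {0}) fun k hk ↦ ?_
    rw [zero_pow (by simpa using hk), zero_mul]
  refine summable_of_ratio_test_tendsto_lt_one (l := 0) zero_lt_one
    (Filter.Eventually.of_forall fun k ↦
      mul_ne_zero (pow_ne_zero _ hx) (factorialWeight_pos β k).ne') ?_
  have e : ∀ k : ℕ, ‖x ^ (k + 1) * factorialWeight β (k + 1)‖ / ‖x ^ k * factorialWeight β k‖ =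
      |x| * ((k + 1 : ℕ) : ℝ) ^ (-β) := by
    intro k
    have h1 := (factorialWeight_pos β k).ne'
    have h2 : factorialWeight β (k + 1) = ((k + 1 : ℕ) : ℝ) ^ (-β) * factorialWeight β k := by
      unfold factorialWeight
      rw [Nat.factorial_succ, Nat.cast_mul, Real.mul_rpow (by positivity) (by positivity), mul_inv,
        Real.rpow_neg (by positivity)]
    have h3 : (0 : ℝ) ≤ ((k + 1 : ℕ) : ℝ) ^ (-β) := by positivity
    rw [h2, norm_mul, norm_mul, norm_mul, norm_pow, norm_pow, pow_succ, Real.norm_eq_abs,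
      Real.norm_of_nonneg h3, Real.norm_of_nonneg (factorialWeight_pos β k).le]
    have h4 : |x| ≠ 0 := abs_ne_zero.2 hx
    field_simp
  simp only [e]
  have h5 := (tendsto_rpow_neg_atTop hβ).comp
    (tendsto_natCast_atTop_atTop.comp (Filter.tendsto_add_atTop_nat 1))
  simpa using h5.const_mul |x|

theorem exists_factorialWeight_bound {T α : ℝ} (hα : 0 < α) {B : ℕ → ℝ → ℝ → R}
    (hB : ∀ k, ChenRelation T B k) {c : ℕ → ℝ}
    (hc : ∀ k, ∀ a b : ℝ, 0 ≤ a → a ≤ b → b < T → ‖B k a b‖ ≤ c k * (b - a) ^ ((k : ℝ) * α)) :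
    ∃ r : ℝ, 0 ≤ r ∧ ∀ k ≠ 0, ∀ a b : ℝ, 0 ≤ a → a ≤ b → b < T →
      ‖B k a b‖ ≤ r ^ k * factorialWeight (α / 2) k * (b - a) ^ ((k : ℝ) * α) := by
  set g := factorialWeight (α / 2)
  have hg : ∀ k, 0 < g k := factorialWeight_pos _
  set q : ℝ := (1 / 2) ^ α
  have hq0 : 0 < q := by positivity
  have hq1 : q < 1 := Real.rpow_lt_one (by norm_num) (by norm_num) hα
  set p : ℝ := (1 / 2) ^ (α / 2)
  have hp0 : 0 < p := by positivity
  have hp1 : p < 1 := Real.rpow_lt_one (by norm_num) (by norm_num) (by linarith)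
  have hqp : q * 2 ^ (α / 2) = p := by
    have e1 : q = p * p := by
      simp only [q, p]
      rw [← Real.rpow_add (by norm_num)]
      congr 1
      ring
    have e2 : p * 2 ^ (α / 2) = 1 := by
      simp only [p]
      rw [← Real.mul_rpow (by norm_num) (by norm_num)]
      norm_num
    rw [e1, mul_assoc, e2, mul_one]
  have hev : ∀ᶠ k : ℕ in Filter.atTop, 2 * |c 0| * q ^ k ≤ 1 / 2 ∧ (k : ℝ) * p ^ k ≤ 1 / 2 := by
    have t1 := (tendsto_pow_atTop_nhds_zero_of_lt_one hq0.le hq1).const_mul (2 * |c 0|)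
    rw [mul_zero] at t1
    exact (t1.eventually_le_const (by norm_num)).and
      ((tendsto_self_mul_const_pow_of_lt_one hp0.le hp1).eventually_le_const (by norm_num))
  obtain ⟨k₀, hk₀⟩ := Filter.eventually_atTop.1 hev
  set r : ℝ := 1 + ∑ k ∈ Finset.range k₀, |c k| / g k with hr
  have hr1 : 1 ≤ r := by
    have : 0 ≤ ∑ k ∈ Finset.range k₀, |c k| / g k :=
      Finset.sum_nonneg fun k _ ↦ div_nonneg (abs_nonneg _) (hg k).le
    linarith
  refine ⟨r, by linarith, fun k ↦ ?_⟩
  induction k using Nat.strong_induction_on with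
  | _ k ih =>
  intro hk
  rcases lt_or_ge k k₀ with hlt | hge
  · intro a b ha hab hb
    refine (hc k a b ha hab hb).trans
      (mul_le_mul_of_nonneg_right ?_ (Real.rpow_nonneg (by linarith) _))
    have h1 : |c k| / g k ≤ r := by
      have := Finset.single_le_sum (f := fun k ↦ |c k| / g k)
        (fun k _ ↦ div_nonneg (abs_nonneg _) (hg k).le) (Finset.mem_range.2 hlt)
      linarith
    rw [div_le_iff₀ (hg k)] at h1
    calc c k ≤ |c k| := le_abs_self _
      _ ≤ r * g k := h1
      _ ≤ r ^ k * g k := mul_le_mul_of_nonneg_right (le_self_pow₀ hr1 hk) (hg k).le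
  obtain ⟨hk1, hk2⟩ := hk₀ k hge
  obtain ⟨n, rfl⟩ := Nat.exists_eq_succ_of_ne_zero hk
  rw [Nat.succ_eq_add_one] at *
  set H := r ^ (n + 1) * g (n + 1)
  have hH : 0 ≤ H := mul_nonneg (pow_nonneg (by linarith) _) (hg _).le
  have hsum : ∀ l : ℝ, 0 ≤ l → ∑ i ∈ Finset.range n,
      r ^ (i + 1) * g (i + 1) * (1 / 2 * l) ^ (((i + 1 : ℕ) : ℝ) * α) *
        (r ^ (n - i) * g (n - i) * (1 / 2 * l) ^ (((n - i : ℕ) : ℝ) * α)) ≤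
      H / 2 * l ^ (((n + 1 : ℕ) : ℝ) * α) := by
    intro l hl
    have hterm : ∀ i ∈ Finset.range n,
        r ^ (i + 1) * g (i + 1) * (1 / 2 * l) ^ (((i + 1 : ℕ) : ℝ) * α) *
          (r ^ (n - i) * g (n - i) * (1 / 2 * l) ^ (((n - i : ℕ) : ℝ) * α)) ≤
        H * p ^ (n + 1) * l ^ (((n + 1 : ℕ) : ℝ) * α) := by
      intro i hi
      rw [Finset.mem_range] at hi
      have hin : i + 1 + (n - i) = n + 1 := by lia
      have e1 : (1 / 2 * l) ^ (((i + 1 : ℕ) : ℝ) * α) * (1 / 2 * l) ^ (((n - i : ℕ) : ℝ) * α) =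
          q ^ (n + 1) * l ^ (((n + 1 : ℕ) : ℝ) * α) := by
        rw [← Real.rpow_add_of_nonneg (by positivity) (by positivity) (by positivity), ← add_mul,
          ← Nat.cast_add, hin, Real.mul_rpow (by norm_num) hl, mul_comm ((n + 1 : ℕ) : ℝ) α,
          Real.rpow_mul (by norm_num), Real.rpow_natCast]
      have e2 := factorialWeight_mul_le (β := α / 2) (by linarith) (i + 1) (n - i)
      rw [hin] at e2
      have hl' : 0 ≤ l ^ (((n + 1 : ℕ) : ℝ) * α) := Real.rpow_nonneg hl _
      have hr0 : 0 ≤ r ^ (n + 1) := pow_nonneg (by linarith) _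
      calc _ = r ^ (i + 1 + (n - i)) * (g (i + 1) * g (n - i)) *
            ((1 / 2 * l) ^ (((i + 1 : ℕ) : ℝ) * α) *
              (1 / 2 * l) ^ (((n - i : ℕ) : ℝ) * α)) := by rw [pow_add]; ring
        _ ≤ r ^ (n + 1) * (((2 : ℝ) ^ (α / 2)) ^ (n + 1) * g (n + 1)) *
            (q ^ (n + 1) * l ^ (((n + 1 : ℕ) : ℝ) * α)) := by
          rw [e1, hin]
          gcongr
        _ = _ := by rw [← hqp, mul_pow]; ring
    refine (Finset.sum_le_sum hterm).trans ?_
    rw [Finset.sum_const, Finset.card_range, nsmul_eq_mul]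
    have hl' : 0 ≤ l ^ (((n + 1 : ℕ) : ℝ) * α) := Real.rpow_nonneg hl _
    have : (n : ℝ) * p ^ (n + 1) ≤ 1 / 2 := by
      refine le_trans ?_ hk2
      gcongr
      simp
    calc _ = H * l ^ (((n + 1 : ℕ) : ℝ) * α) * (n * p ^ (n + 1)) := by ring
      _ ≤ H * l ^ (((n + 1 : ℕ) : ℝ) * α) * (1 / 2) := by gcongr
      _ = _ := by ring
  have iter : ∀ m : ℕ, ∀ a b : ℝ, 0 ≤ a → a ≤ b → b < T →
      ‖B (n + 1) a b‖ ≤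
        (H + |c (n + 1)| * (1 / 2) ^ m) * (b - a) ^ (((n + 1 : ℕ) : ℝ) * α) := by
    intro m
    induction m with
    | zero =>
      intro a b ha hab hb
      refine (hc (n + 1) a b ha hab hb).trans
        (mul_le_mul_of_nonneg_right ?_ (Real.rpow_nonneg (by linarith) _))
      rw [pow_zero, mul_one]
      linarith [le_abs_self (c (n + 1))]
    | succ m ihm =>
      intro a b ha hab hb
      set d := (a + b) / 2 with hd
      have had : a ≤ d := by linarith
      have hdb : d ≤ b := by linarith
      have hl : 0 ≤ b - a := by linarith
      have e1 : b - d = 1 / 2 * (b - a) := by rw [hd]; ring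
      have e2 : d - a = 1 / 2 * (b - a) := by rw [hd]; ring
      have eq1 : (1 / 2 * (b - a)) ^ (((n + 1 : ℕ) : ℝ) * α) =
          q ^ (n + 1) * (b - a) ^ (((n + 1 : ℕ) : ℝ) * α) := by
        rw [Real.mul_rpow (by norm_num) hl, mul_comm ((n + 1 : ℕ) : ℝ) α,
          Real.rpow_mul (by norm_num), Real.rpow_natCast]
      have i1 := ihm d b (by linarith) hdb hb
      have i2 := ihm a d ha had (by linarith)
      rw [e1, eq1] at i1
      rw [e2, eq1] at i2
      have z : ∀ a b : ℝ, 0 ≤ a → a ≤ b → b < T → ‖B 0 a b‖ ≤ |c 0| := fun a b ha hab hb ↦ by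
        have := hc 0 a b ha hab hb
        rw [Nat.cast_zero, zero_mul, Real.rpow_zero, mul_one] at this
        exact this.trans (le_abs_self _)
      rw [hB (n + 1) a d b ha had hdb hb,
        sum_antidiagonal_succ_mul (fun k ↦ B k a d) (fun k ↦ B k d b)]
      set S := (b - a) ^ (((n + 1 : ℕ) : ℝ) * α)
      have hS : 0 ≤ S := Real.rpow_nonneg hl _
      set C := H + |c (n + 1)| * (1 / 2) ^ m with hC
      have hC0 : 0 ≤ C := by positivity
      have j1 : ‖B 0 a d * B (n + 1) d b‖ ≤ |c 0| * (C * (q ^ (n + 1) * S)) :=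
        (norm_mul_le _ _).trans (mul_le_mul (z a d ha had (by linarith)) i1 (norm_nonneg _)
          (abs_nonneg _))
      have j2 : ‖B (n + 1) a d * B 0 d b‖ ≤ C * (q ^ (n + 1) * S) * |c 0| :=
        (norm_mul_le _ _).trans (mul_le_mul i2 (z d b (by linarith) hdb hb) (norm_nonneg _)
          (by positivity))
      have j3 : ‖∑ i ∈ Finset.range n, B (i + 1) a d * B (n - i) d b‖ ≤ H / 2 * S := by
        refine ((norm_sum_le _ _).trans (Finset.sum_le_sum fun i hi ↦ ?_)).trans (hsum _ hl)
        rw [Finset.mem_range] at hi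
        have k1 := ih (i + 1) (by lia) (by lia) a d ha had (by linarith)
        have k2 := ih (n - i) (by lia) (by lia) d b (by linarith) hdb hb
        rw [e2] at k1
        rw [e1] at k2
        exact (norm_mul_le _ _).trans (mul_le_mul k1 k2 (norm_nonneg _)
          ((norm_nonneg _).trans k1))
      have j4 : 2 * |c 0| * q ^ (n + 1) * (C * S) ≤ 1 / 2 * (C * S) :=
        mul_le_mul_of_nonneg_right hk1 (mul_nonneg hC0 hS)
      calc _ ≤ _ := norm_add₃_le
        _ ≤ |c 0| * (C * (q ^ (n + 1) * S)) + C * (q ^ (n + 1) * S) * |c 0| + H / 2 * S := by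
          gcongr
        _ = 2 * |c 0| * q ^ (n + 1) * (C * S) + H / 2 * S := by ring
        _ ≤ 1 / 2 * (C * S) + H / 2 * S := by gcongr
        _ = _ := by rw [hC, pow_succ]; ring
  intro a b ha hab hb
  refine ge_of_tendsto' (x := Filter.atTop) ?_ fun m ↦ iter m a b ha hab hb
  have t := (((tendsto_pow_atTop_nhds_zero_of_lt_one (r := (1 / 2 : ℝ)) (by norm_num)
    (by norm_num)).const_mul |c (n + 1)|).const_add H).mul_const
      ((b - a) ^ (((n + 1 : ℕ) : ℝ) * α))
  simpa using t

/-- A multiplicative functional of degree `n` with `(n + 1) α > 1` extends to all degrees, with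
components bounded by a rapidly decreasing sequence. -/
theorem IsMultiplicativeFunctional.exists_extension_rapid [CompleteSpace R] {T α : ℝ}
    {L : ℕ → AddSubgroup R} {n : ℕ} {A : ℕ → ℝ → ℝ → R}
    (h : IsMultiplicativeFunctional T α L n A) (hα : 0 < α)
    (hn : 1 < ((n : ℝ) + 1) * α) (hLc : ∀ k, IsClosed (L k : Set R))
    (hL : ∀ i j, ∀ x ∈ L i, ∀ y ∈ L j, x * y ∈ L (i + j)) :
    ∃ (B : ℕ → ℝ → ℝ → R) (w : ℕ → ℝ), (∀ k ≤ n, B k = A k) ∧ (∀ k, ChenRelation T B k) ∧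
      (∀ k, ∀ a b : ℝ, 0 ≤ a → a ≤ b → b < T → B k a b ∈ L k) ∧ (∀ k, 0 ≤ w k) ∧
      (∀ x : ℝ, Summable fun k ↦ x ^ k * w k) ∧
      ∀ k, ∀ a b : ℝ, 0 ≤ a → a ≤ b → b < T → ‖B k a b‖ ≤ w k * (b - a) ^ ((k : ℝ) * α) := by
  obtain ⟨B, hB, hBA⟩ := h.exists_extension hα hn hLc hL
  choose c hc using fun k ↦ (hB k).norm_le k le_rfl
  obtain ⟨r, hr, hrB⟩ := exists_factorialWeight_bound hα (fun k ↦ (hB k).chen k le_rfl) hc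
  refine ⟨B, fun k ↦ if k = 0 then |c 0| else r ^ k * factorialWeight (α / 2) k, hBA,
    fun k ↦ (hB k).chen k le_rfl, fun k ↦ (hB k).mem k le_rfl, ?_, ?_, ?_⟩
  · intro k
    dsimp only
    split_ifs
    · exact abs_nonneg _
    · exact mul_nonneg (pow_nonneg hr _) (factorialWeight_pos _ _).le
  · intro x
    refine (summable_nat_add_iff 1).1 ?_
    refine ((summable_nat_add_iff 1).2
      (summable_pow_mul_factorialWeight (half_pos hα) (x * r))).congr fun k ↦ ?_
    dsimp only
    rw [if_neg (Nat.succ_ne_zero k), mul_pow, mul_assoc]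
  · intro k a b ha hab hb
    dsimp only
    split_ifs with hk
    · subst hk
      exact (hc 0 a b ha hab hb).trans
        (mul_le_mul_of_nonneg_right (le_abs_self _) (Real.rpow_nonneg (by linarith) _))
    · exact hrB k hk a b ha hab hb

end Decay

namespace TensorCrossNorms

theorem isClosed_level {E : Type*} [NormedAddCommGroup E] [NormedSpace ℝ E]
    (N : TensorCrossNorms E) (k : ℕ) : IsClosed (N.level k : Set N.Alg) :=
  Submodule.isClosed_topologicalClosure _

theorem mul_mem_level {E : Type*} [NormedAddCommGroup E] [NormedSpace ℝ E]
    (N : TensorCrossNorms E) {i j : ℕ} {x y : N.Alg} (hx : x ∈ N.level i) (hy : y ∈ N.level j) :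
    x * y ∈ N.level (i + j) := by
  refine map_mem_closure₂ continuous_mul hx hy ?_
  rintro _ ⟨u, rfl⟩ _ ⟨v, rfl⟩
  refine ⟨TensorPower.mulEquiv (u ⊗ₜ[ℝ] v), ?_⟩
  change ((N.incl (i + j) (TensorPower.mulEquiv (u ⊗ₜ[ℝ] v)) : N.PreAlg) : N.Alg) =
    ((N.incl i u : N.PreAlg) : N.Alg) * ((N.incl j v : N.PreAlg) : N.Alg)
  rw [← UniformSpace.Completion.coe_mul, incl_mul_incl]

end TensorCrossNorms

section Series

variable {R : Type*} [NormedRing R]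

theorem rpow_le_of_times {T α : ℝ} (hα : 0 < α) (n j : ℕ) {a b : ℝ} (ha : 0 ≤ a) (hab : a ≤ b)
    (hb : b < T) : (b - a) ^ (((n + j : ℕ) : ℝ) * α) ≤
      (|T| ^ α + 1) ^ (n + j) * (b - a) ^ ((n : ℝ) * α) := by
  have hl : 0 ≤ b - a := by linarith
  have hτ : 0 ≤ |T| ^ α := by positivity
  have e : (b - a) ^ (((n + j : ℕ) : ℝ) * α) = ((b - a) ^ α) ^ j * (b - a) ^ ((n : ℝ) * α) := by
    rw [Nat.cast_add, add_mul, Real.rpow_add_of_nonneg hl (by positivity) (by positivity),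
      mul_comm (j : ℝ), Real.rpow_mul hl α, Real.rpow_natCast, mul_comm]
  rw [e]
  refine mul_le_mul_of_nonneg_right ?_ (Real.rpow_nonneg hl _)
  calc ((b - a) ^ α) ^ j ≤ (|T| ^ α + 1) ^ j := by
        refine pow_le_pow_left₀ (Real.rpow_nonneg hl _) ?_ j
        have := Real.rpow_le_rpow hl (by linarith [le_abs_self T] : b - a ≤ |T|) hα.le
        linarith
    _ ≤ (|T| ^ α + 1) ^ (n + j) := pow_le_pow_right₀ (by linarith) (by lia)

/-- The sum of the series `∑ lam^k B^(k)` is multiplicative when it converges absolutely. -/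
theorem isMultiplicative_tsum_smul [NormedAlgebra ℝ R] [CompleteSpace R] {T : ℝ}
    {B : ℕ → ℝ → ℝ → R} (hB : ∀ k, ChenRelation T B k) (lam : ℝ)
    (hs : ∀ a b : ℝ, 0 ≤ a → a ≤ b → b < T → Summable fun k ↦ ‖lam ^ k • B k a b‖) :
    IsMultiplicative T fun a b ↦ ∑' k, lam ^ k • B k a b := by
  intro a c b ha hac hcb hb
  dsimp only
  rw [tsum_mul_tsum_eq_tsum_sum_antidiagonal_of_summable_norm (hs a c ha hac (by linarith))
    (hs c b (by linarith) hcb hb)]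
  refine tsum_congr fun k ↦ ?_
  rw [hB k a c b ha hac hcb hb, Finset.smul_sum]
  refine Finset.sum_congr rfl fun p hp ↦ ?_
  rw [Finset.HasAntidiagonal.mem_antidiagonal] at hp
  rw [smul_mul_smul_comm, ← pow_add, hp]

/-- Two bounded multiplicative functions which are close of order `θ > 1` are equal. -/
theorem IsMultiplicative.eq_of_holderClose {T U θ : ℝ} (hθ : 1 < θ) {u v μ : ℝ → ℝ → R}
    (hu : IsMultiplicative T u) (hv : IsMultiplicative T v)
    (hU : ∀ a b : ℝ, 0 ≤ a → a ≤ b → b < T → ‖u a b‖ ≤ U)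
    (huμ : HolderClose T θ u μ) (hvμ : HolderClose T θ v μ)
    {a b : ℝ} (ha : 0 ≤ a) (hab : a ≤ b) (hb : b < T) : v a b = u a b := by
  obtain ⟨C₁, h₁⟩ := huμ
  obtain ⟨C₂, h₂⟩ := hvμ
  have hW : ∀ a b : ℝ, 0 ≤ a → a ≤ b → b < T →
      ‖v a b - u a b‖ ≤ (C₂ + C₁) * (b - a) ^ θ := fun a b ha hab hb ↦ by
    have := norm_sub_le_norm_sub_add_norm_sub (v a b) (μ a b) (u a b)
    rw [norm_sub_rev (μ a b)] at this
    linarith [h₁ a b ha hab hb, h₂ a b ha hab hb]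
  have hV : ∀ a b : ℝ, 0 ≤ a → a ≤ b → b < T → ‖v a b‖ ≤ U + |C₂ + C₁| * |T| ^ θ :=
    fun a b ha hab hb ↦ by
    have h3 : (C₂ + C₁) * (b - a) ^ θ ≤ |C₂ + C₁| * |T| ^ θ :=
      mul_le_mul (le_abs_self _) (Real.rpow_le_rpow (by linarith)
        (by linarith [le_abs_self T]) (by linarith)) (Real.rpow_nonneg (by linarith) _)
        (abs_nonneg _)
    have h4 := norm_sub_norm_le (v a b) (u a b)
    linarith [hU a b ha hab hb, hW a b ha hab hb]
  refine sub_eq_zero.1 (eq_zero_of_derivation_of_norm_le (W := fun a b ↦ v a b - u a b) hθ hv hu hV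
    (fun a b ha hab hb ↦ (hU a b ha hab hb).trans
      (le_add_of_nonneg_right (by positivity))) ?_ hW ha hab hb)
  intro a c b ha hac hcb hb
  rw [hv a c b ha hac hcb hb, hu a c b ha hac hcb hb, mul_sub, sub_mul]
  abel

/-- Two solutions of the algebraic relations which agree up to degree `n` and which are small of
order `θ > 1` in the higher degrees are equal. -/
theorem eq_of_chenRelation {T M C θ : ℝ} {n : ℕ} (hθ : 1 < θ) {Y Z : ℕ → ℝ → ℝ → R}
    (hY : ∀ k, ChenRelation T Y k) (hZ : ∀ k, ChenRelation T Z k)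
    (hM : ∀ a b : ℝ, 0 ≤ a → a ≤ b → b < T → ‖Y 0 a b‖ ≤ M)
    (hYZ : ∀ k ≤ n, ∀ a b : ℝ, 0 ≤ a → a ≤ b → b < T → Z k a b = Y k a b)
    (hC : ∀ k, n < k → ∀ a b : ℝ, 0 ≤ a → a ≤ b → b < T →
      ‖Z k a b - Y k a b‖ ≤ C * (b - a) ^ θ) (k : ℕ) :
    ∀ a b : ℝ, 0 ≤ a → a ≤ b → b < T → Z k a b = Y k a b := by
  induction k using Nat.strong_induction_on with
  | _ k ih =>
  rcases le_or_gt k n with hk | hk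
  · exact hYZ k hk
  obtain ⟨m, rfl⟩ := Nat.exists_eq_succ_of_ne_zero (by lia : k ≠ 0)
  rw [Nat.succ_eq_add_one] at *
  have hmul : IsMultiplicative T (Y 0) := fun a c b ha hac hcb hb ↦ by
    rw [hY 0 a c b ha hac hcb hb]
    simp
  intro a b ha hab hb
  refine sub_eq_zero.1 (eq_zero_of_derivation_of_norm_le (W := fun a b ↦ Z (m + 1) a b -
    Y (m + 1) a b) hθ hmul hmul hM hM ?_ (hC _ hk) ha hab hb)
  intro a c b ha hac hcb hb
  have hc : 0 ≤ c := ha.trans hac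
  have hcT : c < T := hcb.trans_lt hb
  rw [hY _ a c b ha hac hcb hb, hZ _ a c b ha hac hcb hb,
    sum_antidiagonal_succ_mul (fun k ↦ Y k a c) (fun k ↦ Y k c b),
    sum_antidiagonal_succ_mul (fun k ↦ Z k a c) (fun k ↦ Z k c b)]
  have e : ∑ i ∈ Finset.range m, Z (i + 1) a c * Z (m - i) c b =
      ∑ i ∈ Finset.range m, Y (i + 1) a c * Y (m - i) c b := by
    refine Finset.sum_congr rfl fun i hi ↦ ?_
    rw [Finset.mem_range] at hi
    rw [ih (i + 1) (by lia) a c ha hac hcT, ih (m - i) (by lia) c b hc hcb hb]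
  rw [e, ih 0 (by lia) a c ha hac hcT, ih 0 (by lia) c b hc hcb hb, mul_sub, sub_mul]
  abel

end Series

theorem theorem15 (n : ℕ) (α : ℝ) (hα : 1 / ((n : ℝ) + 1) < α) (T M : ℝ) :
    -- Banach algebras
    (∀ (𝒜 : Type*) [NormedRing 𝒜] [NormedAlgebra ℝ 𝒜] [CompleteSpace 𝒜]
      (A : ℕ → ℝ → ℝ → 𝒜),
      (∀ k ≤ n, ChenRelation T A k) →
      (∀ k ≤ n, ∀ a b : ℝ, 0 ≤ a → a ≤ b → b < T → ‖A k a b‖ ≤ M * (b - a) ^ ((k : ℝ) * α)) →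
      -- the coefficients of the power series do not depend on the parameter
      ∃ B : ℕ → ℝ → ℝ → 𝒜,
        (∀ k ≤ n, ∀ a b : ℝ, 0 ≤ a → a ≤ b → b < T → B k a b = A k a b) ∧
        -- normal convergence, uniformly in the two times, for every value of the parameter
        (∀ lam : ℝ, ∃ w : ℕ → ℝ, Summable w ∧
          ∀ (k : ℕ) (a b : ℝ), 0 ≤ a → a ≤ b → b < T → ‖lam ^ k • B k a b‖ ≤ w k) ∧
        -- existence, expansion and uniqueness of the multiplicative function
        ∀ lam : ℝ, ∃ u : ℝ → ℝ → 𝒜,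
          IsMultiplicative T u ∧
          HolderClose T (((n : ℝ) + 1) * α) u
            (fun a b ↦ ∑ k ∈ Finset.range (n + 1), lam ^ k • A k a b) ∧
          (∀ a b : ℝ, 0 ≤ a → a ≤ b → b < T → HasSum (fun k ↦ lam ^ k • B k a b) (u a b)) ∧
          ∀ v : ℝ → ℝ → 𝒜,
            IsMultiplicative T v →
            HolderClose T (((n : ℝ) + 1) * α) v
              (fun a b ↦ ∑ k ∈ Finset.range (n + 1), lam ^ k • A k a b) →
            ∀ a b : ℝ, 0 ≤ a → a ≤ b → b < T → v a b = u a b) ∧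
    -- completed tensor algebras
    (∀ (E : Type*) [NormedAddCommGroup E] [NormedSpace ℝ E] [CompleteSpace E]
      (N : TensorCrossNorms E) (X : ℕ → ℝ → ℝ → N.Alg),
      (∀ k ≤ n, ∀ a b : ℝ, 0 ≤ a → a ≤ b → b < T → X k a b ∈ N.level k) →
      (∀ k ≤ n, ChenRelation T X k) →
      (∀ k ≤ n, ∀ a b : ℝ, 0 ≤ a → a ≤ b → b < T → ‖X k a b‖ ≤ M * (b - a) ^ ((k : ℝ) * α)) →
      ∃ Y : ℕ → ℝ → ℝ → N.Alg,
        N.IsExtension n T α X Y ∧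
        ∀ Z : ℕ → ℝ → ℝ → N.Alg, N.IsExtension n T α X Z →
          ∀ k, ∀ a b : ℝ, 0 ≤ a → a ≤ b → b < T → Z k a b = Y k a b) := by
  have hn0 : (0 : ℝ) < (n : ℝ) + 1 := by positivity
  have hα0 : 0 < α := (by positivity : (0 : ℝ) < 1 / ((n : ℝ) + 1)).trans hα
  have hn : 1 < ((n : ℝ) + 1) * α := by
    rwa [div_lt_iff₀ hn0, mul_comm] at hα
  set τ : ℝ := |T| ^ α + 1
  have hτ0 : 0 ≤ τ := by positivity
  have htail : ∀ {w : ℕ → ℝ}, (∀ k, 0 ≤ w k) → ∀ (j : ℕ) (a b : ℝ), 0 ≤ a → a ≤ b → b < T →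
      w (n + 1 + j) * (b - a) ^ (((n + 1 + j : ℕ) : ℝ) * α) ≤
        τ ^ (n + 1 + j) * w (n + 1 + j) * (b - a) ^ (((n : ℝ) + 1) * α) := by
    intro w hw j a b ha hab hb
    have h1 := mul_le_mul_of_nonneg_left (rpow_le_of_times hα0 (n + 1) j ha hab hb)
      (hw (n + 1 + j))
    rw [Nat.cast_add_one n] at h1
    refine h1.trans_eq ?_
    ring
  refine ⟨?_, ?_⟩
  · intro 𝒜 _ _ _ A hA hAM
    have hF : IsMultiplicativeFunctional T α (fun _ ↦ (⊤ : AddSubgroup 𝒜)) n A :=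
      ⟨hA, fun _ _ _ _ _ _ _ ↦ AddSubgroup.mem_top _, fun k hk ↦ ⟨M, hAM k hk⟩⟩
    obtain ⟨B, w, hBA, hB, -, hw, hws, hBw⟩ := hF.exists_extension_rapid hα0 hn
      (fun _ ↦ isClosed_univ) (fun _ _ _ _ _ _ ↦ AddSubgroup.mem_top _)
    have hbound : ∀ (lam : ℝ) (k : ℕ) (a b : ℝ), 0 ≤ a → a ≤ b → b < T →
        ‖lam ^ k • B k a b‖ ≤ (|lam| * τ) ^ k * w k := by
      intro lam k a b ha hab hb
      have h1 := rpow_le_of_times hα0 0 k ha hab hb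
      rw [zero_add, Nat.cast_zero, zero_mul, Real.rpow_zero, mul_one] at h1
      calc ‖lam ^ k • B k a b‖ = |lam| ^ k * ‖B k a b‖ := by
            rw [norm_smul, norm_pow, Real.norm_eq_abs]
        _ ≤ |lam| ^ k * (w k * τ ^ k) := by
          gcongr
          exact (hBw k a b ha hab hb).trans (mul_le_mul_of_nonneg_left h1 (hw k))
        _ = _ := by rw [mul_pow]; ring
    have hsum : ∀ (lam a b : ℝ), 0 ≤ a → a ≤ b → b < T →
        Summable fun k ↦ ‖lam ^ k • B k a b‖ := fun lam a b ha hab hb ↦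
      (hws (|lam| * τ)).of_nonneg_of_le (fun _ ↦ norm_nonneg _)
        fun k ↦ hbound lam k a b ha hab hb
    refine ⟨B, fun k hk a b _ _ _ ↦ by rw [hBA k hk],
      fun lam ↦ ⟨_, hws (|lam| * τ), hbound lam⟩, fun lam ↦ ?_⟩
    have hmul := isMultiplicative_tsum_smul hB lam (hsum lam)
    have hclose : HolderClose T (((n : ℝ) + 1) * α) (fun a b ↦ ∑' k, lam ^ k • B k a b)
        (fun a b ↦ ∑ k ∈ Finset.range (n + 1), lam ^ k • A k a b) := by
      have hs := (summable_nat_add_iff (n + 1)).2 (hws (|lam| * τ))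
      refine ⟨∑' j, (|lam| * τ) ^ (j + (n + 1)) * w (j + (n + 1)), fun a b ha hab hb ↦ ?_⟩
      have e : ∑ k ∈ Finset.range (n + 1), lam ^ k • A k a b =
          ∑ k ∈ Finset.range (n + 1), lam ^ k • B k a b :=
        Finset.sum_congr rfl fun k hk ↦ by
          rw [Finset.mem_range] at hk
          rw [hBA k (by lia)]
      dsimp only
      rw [e, ← (hsum lam a b ha hab hb).of_norm.sum_add_tsum_nat_add (n + 1), add_sub_cancel_left,
        ← tsum_mul_right]
      refine tsum_of_norm_bounded (hs.mul_right _).hasSum fun j ↦ ?_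
      rw [norm_smul, norm_pow, Real.norm_eq_abs, add_comm j]
      calc |lam| ^ (n + 1 + j) * ‖B (n + 1 + j) a b‖ ≤ |lam| ^ (n + 1 + j) *
            (τ ^ (n + 1 + j) * w (n + 1 + j) * (b - a) ^ (((n : ℝ) + 1) * α)) := by
            gcongr
            exact (hBw _ a b ha hab hb).trans (htail hw j a b ha hab hb)
        _ = _ := by rw [mul_pow]; ring
    refine ⟨fun a b ↦ ∑' k, lam ^ k • B k a b, hmul, hclose,
      fun a b ha hab hb ↦ (hsum lam a b ha hab hb).of_norm.hasSum, ?_⟩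
    intro v hv hvclose a b ha hab hb
    exact hmul.eq_of_holderClose hn hv (fun a b ha hab hb ↦
      tsum_of_norm_bounded (hws (|lam| * τ)).hasSum fun k ↦ hbound lam k a b ha hab hb)
      hclose hvclose ha hab hb
  · intro E _ _ _ N X hXL hX hXM
    have hF : IsMultiplicativeFunctional T α (fun k ↦ (N.level k).toAddSubgroup) n X :=
      ⟨hX, hXL, fun k hk ↦ ⟨M, hXM k hk⟩⟩
    obtain ⟨Y, w, hYX, hY, hYL, hw, hws, hYw⟩ := hF.exists_extension_rapid hα0 hn
      N.isClosed_level (fun _ _ _ hx _ hy ↦ N.mul_mem_level hx hy)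
    have hs : Summable fun j ↦ τ ^ (n + 1 + j) * w (n + 1 + j) :=
      ((summable_nat_add_iff (n + 1)).2 (hws τ)).congr fun j ↦ by rw [add_comm j]
    have hYtail : ∀ a b : ℝ, 0 ≤ a → a ≤ b → b < T → ∀ j, ‖Y (n + 1 + j) a b‖ ≤
        τ ^ (n + 1 + j) * w (n + 1 + j) * (b - a) ^ (((n : ℝ) + 1) * α) :=
      fun a b ha hab hb j ↦ (hYw _ a b ha hab hb).trans (htail hw j a b ha hab hb)
    have hYsum : ∀ a b : ℝ, 0 ≤ a → a ≤ b → b < T → Summable fun j ↦ ‖Y (n + 1 + j) a b‖ :=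
      fun a b ha hab hb ↦ (hs.mul_right _).of_nonneg_of_le (fun _ ↦ norm_nonneg _)
        (hYtail a b ha hab hb)
    have hYC : ∀ a b : ℝ, 0 ≤ a → a ≤ b → b < T → ∑' j, ‖Y (n + 1 + j) a b‖ ≤
        (∑' j, τ ^ (n + 1 + j) * w (n + 1 + j)) * (b - a) ^ (((n : ℝ) + 1) * α) := by
      intro a b ha hab hb
      rw [← tsum_mul_right]
      exact (hYsum a b ha hab hb).tsum_le_tsum (hYtail a b ha hab hb) (hs.mul_right _)
    refine ⟨Y, ⟨hYL, fun k hk a b _ _ _ ↦ by rw [hYX k hk], hY, _, fun a b ha hab hb ↦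
      ⟨hYsum a b ha hab hb, hYC a b ha hab hb⟩⟩, ?_⟩
    rintro Z ⟨-, hZX, hZ, C, hZC⟩ k
    refine eq_of_chenRelation (n := n) (M := w 0)
      (C := C + ∑' j, τ ^ (n + 1 + j) * w (n + 1 + j)) hn hY hZ ?_ ?_ ?_ k
    · intro a b ha hab hb
      simpa using hYw 0 a b ha hab hb
    · intro k hk a b ha hab hb
      rw [hZX k hk a b ha hab hb, hYX k hk]
    · intro k hk a b ha hab hb
      obtain ⟨j, rfl⟩ := Nat.exists_eq_add_of_le (Nat.succ_le_of_lt hk)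
      rw [Nat.succ_eq_add_one]
      obtain ⟨hZs, hZle⟩ := hZC a b ha hab hb
      have h1 := (hZs.le_tsum j fun _ _ ↦ norm_nonneg _).trans hZle
      have h2 := ((hYsum a b ha hab hb).le_tsum j fun _ _ ↦ norm_nonneg _).trans
        (hYC a b ha hab hb)
      rw [add_mul]
      exact (norm_sub_le _ _).trans (add_le_add h1 h2)
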